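/- For $\alpha\in\mathbb C$ with $\operatorname{Re}\alpha>0$ put $q=e^{-\alpha}$, $q_1=e^{-\pi^2/\alpha}$, and for real $r$ put $q^r=e^{-r\alpha}$, $q_1^r=e^{-r\pi^2/\alpha}$. Let $$W_3(\alpha)=\int_0^\infty e^{-3\alpha x^2}\,\frac{\sinh(\alpha x)}{\sinh(3\alpha x)}\,dx .$$ Fix $\theta_0$ with $0<\theta_0<\pi/2$. Then there is a unique holomorphic function $\omega:\mathbb D\to\mathbb C$ on the open unit disk $\mathbb D$ that satisfies both 1. the transformation law $$q^{2/3}\,\omega(-q)=-\sqrt{\frac{\pi}{\alpha}}\;q_1^{2/3}\,\omega(-q_1)+\sqrt{\frac{12\alpha}{\pi}}\;W_3(\alpha)\qquad\text{for all real }\alpha>0,$$ 2. the growth bound $$\omega(e^{-\alpha})=O\!\left(|\alpha|^{-1/2}\,|q_1|^{-1/12}\right)\qquad\text{as }\alpha\to0,\ \alpha\ne0,\ |\arg\alpha|\le\theta_0 .$$ -/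

import Mathlib

open Asymptotics Filter Topology

noncomputable section

namespace MockThree

/-- The power `q ^ r` of the nome `q = e ^ (-α)`, with the convention `q ^ r = e ^ (-r α)`. -/
def qPow (r : ℝ) (α : ℂ) : ℂ := Complex.exp (-(r * α))

/-- The power `q₁ ^ r` of the dual nome `q₁ = e ^ (-π² / α)`, with the convention
`q₁ ^ r = e ^ (-r π² / α)`. -/
def q₁Pow (r : ℝ) (α : ℂ) : ℂ := Complex.exp (-(r * ((Real.pi : ℂ) ^ 2 / α)))

/-- The nome `q = e ^ (-α)`. -/
def q (α : ℂ) : ℂ := Complex.exp (-α)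

/-- The dual nome `q₁ = e ^ (-π² / α)`. -/
def q₁ (α : ℂ) : ℂ := Complex.exp (-((Real.pi : ℂ) ^ 2 / α))

/-- The Mordell-Appell integral
`W₃(α) = ∫₀^∞ e ^ (-3 α x²) sinh (α x) / sinh (3 α x) dx`, meaningful for `Re α > 0`. -/
def W₃ (α : ℂ) : ℂ :=
  ∫ x in Set.Ioi (0 : ℝ),
    Complex.exp (-3 * α * (x : ℂ) ^ 2) *
      (Complex.sinh (α * x) / Complex.sinh (3 * α * x))

/-- The transformation law relating the values of `ω` at `-q` and `-q₁`, for all real `α > 0`: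
`q^(2/3) ω(-q) = -√(π/α) q₁^(2/3) ω(-q₁) + √(12α/π) W₃(α)`. -/
def TransformationLaw (ω : ℂ → ℂ) : Prop :=
  ∀ α : ℝ, 0 < α →
    qPow (2 / 3) α * ω (-q α) =
      -(Real.sqrt (Real.pi / α) : ℂ) * q₁Pow (2 / 3) α * ω (-q₁ α) +
        (Real.sqrt (12 * α / Real.pi) : ℂ) * W₃ α

/-- The closed sector `|arg α| ≤ θ₀`, with its vertex `0` removed. -/
def sector (θ₀ : ℝ) : Set ℂ := {α : ℂ | α ≠ 0 ∧ |Complex.arg α| ≤ θ₀}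

/-- The growth bound `ω(e^(-α)) ≲ |α|^(-1/2) |q₁|^(-1/12)` as `α → 0` with `|arg α| ≤ θ₀`. -/
def GrowthBound (θ₀ : ℝ) (ω : ℂ → ℂ) : Prop :=
  (fun α : ℂ => ω (Complex.exp (-α))) =O[𝓝[sector θ₀] 0]
    (fun α : ℂ => ‖α‖ ^ (-(1 / 2) : ℝ) * ‖q₁ α‖ ^ (-(1 / 12) : ℝ))

/-- `ω` is holomorphic in the open unit disk and satisfies the transformation law and the growth
bound. Only the values of `ω` in the open unit disk matter. -/
structure IsSolution (θ₀ : ℝ) (ω : ℂ → ℂ) : Prop where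
  holomorphic : DifferentiableOn ℂ ω (Metric.ball (0 : ℂ) 1)
  law : TransformationLaw ω
  growth : GrowthBound θ₀ ω

end MockThree

end

/-! Uniqueness. The difference `δ` of two solutions satisfies the law without the integral. Put τ =
iα/π and h(τ) = e^(2πiτ/3) δ(-e^(πiτ)). Up to factors of modulus one, h then behaves like a form of
weight 1/2 on the theta group, which is generated by τ ↦ τ + 2 and τ ↦ -1/τ. The product of h⁴ over
the three cosets of that group, `liftNorm`, has the modulus of a form of weight six on the full
modular group. Two of its factors decay like e^(-8π Im τ/3), because `δ` is bounded near 0. The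
third looks at the cusp 1, where the growth bound allows at most e^(π Im τ/3). The product is
therefore O(e^(-5π Im τ)), that is, of order 5/2 in e^(2πiτ), whereas the valence formula leaves a
nonzero form of weight six only 1/2. `eq_zero_of_weight_six` replaces the valence formula by the
maximum principle, which needs only moduli. Hence one factor, and with it `δ`, vanishes.

Existence. The solution is the mock theta function `omega`, an alternating series divided by Euler's
product. At -q the series becomes `tanhSeries` and the product becomes η (`qPow_mul_omega`). Poisson
summation turns `tanhSeries` into an alternating sum of the integrals `mordell`. Moving the contour
over one pole of tanh lowers the frequency by three and leaves a residue, and the lowest integral is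
a multiple of `W₃`. The coefficients of `W₃` add up to η at the dual point by the pentagonal number
theorem, while the residues form a double series that adds up to the dual `tanhSeries`. Dividing by
η and using its inversion formula gives the law.

Growth. Summation by parts bounds the numerator by O(1/|α|) in the sector. Inversion of η bounds
Euler's product below by a multiple of |α|^(-1/2) |q₁|^(1/12). -/

namespace MockThree

open Complex Metric

/-! ### Lifting the homogeneous law to the upper half plane -/

/-- Two analytic functions that agree along a curve through a point of a preconnected open set
agree on the whole set. -/
lemma eqOn_of_eq_on_curve {f g : ℂ → ℂ} {U : Set ℂ} (hU : IsOpen U) (hc : IsPreconnected U)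
    (hf : DifferentiableOn ℂ f U) (hg : DifferentiableOn ℂ g U) {γ : ℝ → ℂ} {t₀ : ℝ}
    (hγ : ContinuousAt γ t₀) (hinj : Function.Injective γ) (ht₀ : γ t₀ ∈ U)
    (heq : ∀ᶠ t in 𝓝 t₀, f (γ t) = g (γ t)) : Set.EqOn f g U := by
  refine (hf.analyticOnNhd hU).eqOn_of_preconnected_of_frequently_eq (hg.analyticOnNhd hU) hc ht₀ ?_
  have ht : Tendsto γ (𝓝[≠] t₀) (𝓝[≠] (γ t₀)) :=
    tendsto_nhdsWithin_of_tendsto_nhds_of_eventually_within _ (hγ.mono_left nhdsWithin_le_nhds)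
      (eventually_nhdsWithin_of_forall fun t h => fun h' => h (hinj h'))
  exact ht.frequently (heq.filter_mono nhdsWithin_le_nhds).frequently

lemma isOpen_im_gt (c : ℝ) : IsOpen {τ : ℂ | c < τ.im} := isOpen_lt continuous_const continuous_im

lemma isPreconnected_im_gt (c : ℝ) : IsPreconnected {τ : ℂ | c < τ.im} :=
  (convex_halfSpace_im_gt c).isPreconnected

lemma norm_exp_I_mul (c : ℝ) (τ : ℂ) : ‖exp (c * I * τ)‖ = Real.exp (-c * τ.im) := by
  rw [norm_exp]; simp

lemma neg_exp_mem_ball {τ : ℂ} (hτ : 0 < τ.im) : -exp (Real.pi * I * τ) ∈ ball (0 : ℂ) 1 := by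
  rw [mem_ball_zero_iff, norm_neg, norm_exp_I_mul, Real.exp_lt_one_iff]
  nlinarith [Real.pi_pos]

/-- The lift `h(τ) = e^(2πiτ/3) δ(-e^(πiτ))` of a function on the disk to the upper half plane. -/
noncomputable def lift (δ : ℂ → ℂ) (τ : ℂ) : ℂ :=
  exp ((2 * Real.pi / 3 : ℝ) * I * τ) * δ (-exp (Real.pi * I * τ))

lemma differentiableOn_lift {δ : ℂ → ℂ} (hδ : DifferentiableOn ℂ δ (ball 0 1)) :
    DifferentiableOn ℂ (lift δ) {τ | 0 < τ.im} := by
  unfold lift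
  refine DifferentiableOn.mul (by fun_prop) (hδ.comp (by fun_prop) fun τ hτ => neg_exp_mem_ball hτ)

lemma norm_lift_add_two (δ : ℂ → ℂ) (τ : ℂ) : ‖lift δ (τ + 2)‖ = ‖lift δ τ‖ := by
  have : exp (Real.pi * I * (τ + 2)) = exp (Real.pi * I * τ) := by
    rw [mul_add, exp_add, show (Real.pi : ℂ) * I * 2 = 2 * Real.pi * I by ring, exp_two_pi_mul_I,
      mul_one]
  unfold lift
  rw [this, norm_mul, norm_mul, norm_exp_I_mul, norm_exp_I_mul]
  simp

lemma im_neg_inv_pos {τ : ℂ} (hτ : 0 < τ.im) : 0 < (-1 / τ).im := by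
  have : 0 < normSq τ := normSq_pos.2 (by rintro rfl; simp at hτ)
  rw [neg_div, neg_im, one_div, inv_im, neg_div, neg_neg]
  positivity

/-- On the imaginary axis, with α = πt and τ = it, this is the square of the law; analytic
continuation does the rest. Squaring removes the sign and the choice of a branch of √(-iτ). -/
lemma lift_neg_inv_sq {δ : ℂ → ℂ} (hδ : DifferentiableOn ℂ δ (ball 0 1))
    (hlaw : ∀ α : ℝ, 0 < α → qPow (2 / 3) α * δ (-q α) =
      -(Real.sqrt (Real.pi / α) : ℂ) * q₁Pow (2 / 3) α * δ (-q₁ α))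
    {τ : ℂ} (hτ : 0 < τ.im) : lift δ (-1 / τ) ^ 2 = -I * τ * lift δ τ ^ 2 := by
  have hd := differentiableOn_lift hδ
  have hinv : DifferentiableOn ℂ (fun τ : ℂ => -1 / τ) {τ | 0 < τ.im} := fun τ (hτ : 0 < τ.im) =>
    ((differentiableAt_const _).div differentiableAt_id
      (by rintro rfl; simp at hτ)).differentiableWithinAt
  refine eqOn_of_eq_on_curve (f := fun τ => lift δ (-1 / τ) ^ 2)
    (g := fun τ => -I * τ * lift δ τ ^ 2) (γ := fun t : ℝ => t * I) (t₀ := 1)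
    (isOpen_im_gt 0) (isPreconnected_im_gt 0)
    ((hd.comp hinv fun τ hτ => im_neg_inv_pos hτ).pow 2) (by fun_prop) (by fun_prop)
    (fun s t h => by simpa using h) (by simp) ?_ hτ
  filter_upwards [lt_mem_nhds one_pos] with t ht
  have hπ := Real.pi_pos
  have htc : (t : ℂ) ≠ 0 := by exact_mod_cast ht.ne'
  have hπc : (Real.pi : ℂ) ≠ 0 := by exact_mod_cast hπ.ne'
  have h := hlaw (Real.pi * t) (by positivity)
  have e1 : lift δ (t * I) = qPow (2 / 3) (Real.pi * t : ℝ) * δ (-q (Real.pi * t : ℝ)) := by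
    unfold lift qPow q
    congr 2
    · push_cast; linear_combination (2 * Real.pi * t / 3 : ℂ) * I_sq
    · congr 2; push_cast; linear_combination (Real.pi * t : ℂ) * I_sq
  have e2 : lift δ (-1 / (t * I)) = q₁Pow (2 / 3) (Real.pi * t : ℝ) * δ (-q₁ (Real.pi * t : ℝ)) := by
    unfold lift q₁Pow q₁
    congr 2
    · push_cast; field_simp
    · congr 2; push_cast; field_simp
  rw [e1, e2, h]
  have hs : ((Real.sqrt (Real.pi / (Real.pi * t)) : ℝ) : ℂ) ^ 2 = 1 / t := by
    rw [← ofReal_pow, Real.sq_sqrt (by positivity)]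
    push_cast; field_simp
  rw [mul_assoc (-((Real.sqrt _ : ℝ) : ℂ)), mul_pow (-((Real.sqrt _ : ℝ) : ℂ)), neg_sq, hs]
  field_simp
  linear_combination (q₁Pow (2 / 3) (Real.pi * t : ℝ) * δ (-q₁ (Real.pi * t : ℝ))) ^ 2 * I_sq

/-! ### The weight six norm and its modular invariance -/

/-- The norm of the lift over the three cosets of the theta group in the modular group, a
form of weight six. -/
noncomputable def liftNorm (δ : ℂ → ℂ) (τ : ℂ) : ℂ :=
  lift δ τ ^ 4 * lift δ (τ + 1) ^ 4 * (lift δ (1 - 1 / τ) ^ 4 / τ ^ 2)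

lemma ne_zero_of_im_pos {τ : ℂ} (hτ : 0 < τ.im) : τ ≠ 0 := by rintro rfl; simp at hτ

lemma im_one_sub_inv_pos {τ : ℂ} (hτ : 0 < τ.im) : 0 < (1 - 1 / τ).im := by
  have := im_neg_inv_pos hτ
  rw [show (1 : ℂ) - 1 / τ = 1 + -1 / τ by ring]
  simpa using this

lemma differentiableOn_liftNorm {δ : ℂ → ℂ} (hδ : DifferentiableOn ℂ δ (ball 0 1)) :
    DifferentiableOn ℂ (liftNorm δ) {τ | 0 < τ.im} := by
  have hd := differentiableOn_lift hδ
  have hinv : DifferentiableOn ℂ (fun τ : ℂ => 1 - 1 / τ) {τ | 0 < τ.im} :=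
    fun τ (hτ : 0 < τ.im) => ((differentiableAt_const _).sub ((differentiableAt_const _).div
      differentiableAt_id (ne_zero_of_im_pos hτ))).differentiableWithinAt
  refine ((hd.pow 4).mul ((hd.comp (by fun_prop) fun τ hτ => ?_).pow 4)).mul
    (((hd.comp hinv fun τ hτ => im_one_sub_inv_pos hτ).pow 4).div (by fun_prop)
      fun τ hτ => pow_ne_zero 2 (ne_zero_of_im_pos hτ))
  simpa using hτ

lemma norm_lift_neg_inv {δ : ℂ → ℂ}
    (hS : ∀ τ : ℂ, 0 < τ.im → lift δ (-1 / τ) ^ 2 = -I * τ * lift δ τ ^ 2) {τ : ℂ} (hτ : 0 < τ.im) :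
    ‖lift δ (-1 / τ)‖ ^ 4 = ‖τ‖ ^ 2 * ‖lift δ τ‖ ^ 4 := by
  have := congrArg norm (hS τ hτ)
  simp only [norm_pow, norm_mul, norm_neg, norm_I, one_mul] at this
  calc ‖lift δ (-1 / τ)‖ ^ 4 = (‖lift δ (-1 / τ)‖ ^ 2) ^ 2 := by ring
    _ = _ := by rw [this]; ring

lemma norm_liftNorm (δ : ℂ → ℂ) (τ : ℂ) : ‖liftNorm δ τ‖ =
    ‖lift δ τ‖ ^ 4 * ‖lift δ (τ + 1)‖ ^ 4 * (‖lift δ (1 - 1 / τ)‖ ^ 4 / ‖τ‖ ^ 2) := by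
  simp [liftNorm]

lemma norm_lift_sub_one (δ : ℂ → ℂ) (τ : ℂ) : ‖lift δ (τ - 1)‖ = ‖lift δ (τ + 1)‖ := by
  rw [← norm_lift_add_two δ (τ - 1)]; congr 2; ring

/-- The translation exchanges the first two factors, by period two. It preserves the third, because
-1/(1 - 1/(τ + 1)) = -1/τ - 1 differs from 1 - 1/τ by two; the weight of the inversion absorbs the
denominators. -/
lemma norm_liftNorm_add_one {δ : ℂ → ℂ}
    (hS : ∀ τ : ℂ, 0 < τ.im → lift δ (-1 / τ) ^ 2 = -I * τ * lift δ τ ^ 2) {τ : ℂ} (hτ : 0 < τ.im) : ‖liftNorm δ (τ + 1)‖ = ‖liftNorm δ τ‖ := by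
  have h0 := ne_zero_of_im_pos hτ
  have h1' : 0 < (τ + 1).im := by simpa using hτ
  have h1 := ne_zero_of_im_pos h1'
  have hσ := im_one_sub_inv_pos h1'
  have hσ0 := ne_zero_of_im_pos hσ
  have e := norm_lift_neg_inv hS hσ
  have e2 : -1 / (1 - 1 / (τ + 1)) = -1 / τ - 1 := by
    have : 1 - 1 / (τ + 1) = τ / (τ + 1) := by field_simp; ring
    rw [this]; field_simp; ring
  have e3 : ‖(1 - 1 / (τ + 1) : ℂ)‖ = ‖τ‖ / ‖τ + 1‖ := by
    rw [← norm_div]; congr 1; field_simp; ring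
  rw [e2, norm_lift_sub_one, e3] at e
  rw [norm_liftNorm, norm_liftNorm, show τ + 1 + 1 = τ + 2 by ring, norm_lift_add_two,
    show (1 : ℂ) - 1 / τ = -1 / τ + 1 by ring, e]
  have : ‖τ‖ ≠ 0 := by simpa
  have : ‖τ + 1‖ ≠ 0 := by simpa
  field_simp

/-- The inversion fixes the first coset, at the cost of |τ|², and exchanges the other two; the
denominator τ² supplies the remaining |τ|⁴. -/
lemma norm_liftNorm_neg_inv {δ : ℂ → ℂ}
    (hS : ∀ τ : ℂ, 0 < τ.im → lift δ (-1 / τ) ^ 2 = -I * τ * lift δ τ ^ 2) {τ : ℂ} (hτ : 0 < τ.im) :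
    ‖liftNorm δ (-1 / τ)‖ = ‖τ‖ ^ 6 * ‖liftNorm δ τ‖ := by
  have h0 := ne_zero_of_im_pos hτ
  have e := norm_lift_neg_inv hS hτ
  have e1 : (1 : ℂ) - 1 / (-1 / τ) = τ + 1 := by field_simp; ring
  rw [norm_liftNorm, norm_liftNorm, e, e1, show (1 : ℂ) - 1 / τ = -1 / τ + 1 by ring, norm_div]
  have : ‖τ‖ ≠ 0 := by simpa
  simp only [norm_neg, norm_one]
  field_simp

lemma norm_liftNorm_add_intCast {δ : ℂ → ℂ}
    (hS : ∀ τ : ℂ, 0 < τ.im → lift δ (-1 / τ) ^ 2 = -I * τ * lift δ τ ^ 2) {τ : ℂ}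
    (hτ : 0 < τ.im) (n : ℤ) : ‖liftNorm δ (τ + n)‖ = ‖liftNorm δ τ‖ := by
  induction n with
  | zero => simp
  | succ k ih =>
    rw [← ih, ← norm_liftNorm_add_one hS (τ := τ + ((k : ℤ) : ℂ)) (by simpa using hτ)]
    congr 2; push_cast; ring
  | pred k ih =>
    rw [← ih, ← norm_liftNorm_add_one hS (τ := τ + ((-k - 1 : ℤ) : ℂ)) (by simpa using hτ)]
    congr 2; push_cast; ring

/-! ### Decay of the norm at infinity -/

lemma exists_norm_lift_le {δ : ℂ → ℂ} (hδ : DifferentiableOn ℂ δ (ball 0 1)) :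
    ∃ C : ℝ, 0 ≤ C ∧ ∀ τ : ℂ, 1 ≤ τ.im →
      ‖lift δ τ‖ ≤ C * Real.exp (-(2 * Real.pi / 3) * τ.im) := by
  have hsub : closedBall (0 : ℂ) (Real.exp (-Real.pi)) ⊆ ball 0 1 :=
    closedBall_subset_ball (by rw [Real.exp_lt_one_iff]; linarith [Real.pi_pos])
  obtain ⟨C, hC⟩ := (isCompact_closedBall (0 : ℂ) (Real.exp (-Real.pi))).exists_bound_of_continuousOn
    (hδ.continuousOn.mono hsub)
  refine ⟨C, (norm_nonneg _).trans (hC 0 (by simp [Real.exp_nonneg])), fun τ hτ => ?_⟩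
  rw [lift, norm_mul, norm_exp_I_mul, mul_comm C]
  refine mul_le_mul_of_nonneg_left (hC _ ?_) (Real.exp_nonneg _)
  rw [mem_closedBall_zero_iff, norm_neg, norm_exp_I_mul, Real.exp_le_exp]
  nlinarith [Real.pi_pos]

/-- With τ = x + iy, πi/τ is a positive multiple of 1 + i x/y, whose argument tends to 0 uniformly
for |x| ≤ 1. A sector of any positive opening is therefore enough for uniqueness. -/
lemma exists_mem_sector_of_im_large {θ₀ : ℝ} (hθ₀ : 0 < θ₀) : ∃ Y : ℝ, 1 ≤ Y ∧ ∀ τ : ℂ,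
    Y ≤ τ.im → |τ.re| ≤ 1 → Real.pi * I / τ ∈ sector θ₀ := by
  have hc : ContinuousAt arg 1 := continuousAt_arg (by simp)
  obtain ⟨η, hη, hb⟩ := Metric.continuousAt_iff.1 hc θ₀ hθ₀
  refine ⟨max 1 (2 / η), le_max_left _ _, fun τ hτ hre => ⟨?_, ?_⟩⟩
  · have : τ ≠ 0 := ne_zero_of_im_pos (by linarith [le_max_left 1 (2 / η)])
    simp [Real.pi_ne_zero, this]
  have hy1 : 1 ≤ τ.im := (le_max_left _ _).trans hτ
  have hy2 : 2 / η ≤ τ.im := (le_max_right _ _).trans hτ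
  have hy : 0 < τ.im := by linarith
  have h0 := ne_zero_of_im_pos hy
  have hn : 0 < normSq τ := normSq_pos.2 h0
  have e : (Real.pi * I / τ : ℂ) =
      ((Real.pi * τ.im / normSq τ : ℝ) : ℂ) * (1 + (τ.re / τ.im : ℝ) * I) := by
    have hyc : (τ.im : ℂ) ≠ 0 := by exact_mod_cast hy.ne'
    have hnc : (normSq τ : ℂ) ≠ 0 := by exact_mod_cast hn.ne'
    have hm : (normSq τ : ℂ) = τ * (τ.re - τ.im * I) := by
      rw [normSq_eq_conj_mul_self, mul_comm]; congr 1
      apply Complex.ext <;> simp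
    push_cast
    rw [div_eq_iff h0]
    field_simp
    rw [hm]
    linear_combination (-τ * τ.im) * I_sq
  rw [e, arg_real_mul _ (by positivity)]
  have := hb (x := 1 + (τ.re / τ.im : ℝ) * I) (by
    rw [dist_eq_norm, add_sub_cancel_left, norm_mul, norm_I, mul_one, norm_real, Real.norm_eq_abs,
      abs_div, abs_of_pos hy, div_lt_iff₀ hy]
    rw [div_le_iff₀ hη] at hy2
    linarith [mul_comm τ.im η])
  simpa [dist_eq_norm] using this.le

/-- The argument of `δ` in the lift at 1 - 1/τ is e^(-α) with α = πi/τ, and |q₁| = e^(-π Im τ). In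
the fourth power the factor |α|^(-1/2) gives |τ|²/π², which the denominator cancels, and
|q₁|^(-1/12) gives e^(π Im τ/3). -/
lemma exists_norm_lift_one_sub_inv_le {θ₀ : ℝ} (hθ₀ : 0 < θ₀) {δ : ℂ → ℂ}
    (hg : GrowthBound θ₀ δ) : ∃ C Y : ℝ, 0 ≤ C ∧ 1 ≤ Y ∧ ∀ τ : ℂ, Y ≤ τ.im → |τ.re| ≤ 1 →
      ‖lift δ (1 - 1 / τ)‖ ^ 4 / ‖τ‖ ^ 2 ≤ C * Real.exp (Real.pi / 3 * τ.im) := by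
  obtain ⟨C, hC, hb⟩ := hg.exists_pos
  rw [isBigOWith_iff] at hb
  obtain ⟨ε, hε, hb⟩ := (Metric.nhdsWithin_basis_ball.eventually_iff).1 hb
  obtain ⟨Y, hY, hsec⟩ := exists_mem_sector_of_im_large hθ₀
  have hπ := Real.pi_pos
  refine ⟨C ^ 4 / Real.pi ^ 2, max Y (2 * Real.pi / ε), by positivity,
    hY.trans (le_max_left _ _), fun τ hτ hre => ?_⟩
  have hyY : Y ≤ τ.im := (le_max_left _ _).trans hτ
  have hy2 : 2 * Real.pi / ε ≤ τ.im := (le_max_right _ _).trans hτ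
  have hy : 0 < τ.im := by linarith
  have h0 := ne_zero_of_im_pos hy
  have hn : 0 < ‖τ‖ := norm_pos_iff.2 h0
  have hyn : τ.im ≤ ‖τ‖ := (le_abs_self _).trans (abs_im_le_norm τ)
  have hna : ‖(Real.pi * I / τ : ℂ)‖ = Real.pi / ‖τ‖ := by
    simp [abs_of_pos hπ]
  have h1 := hb (x := Real.pi * I / τ) ⟨by
    rw [mem_ball_zero_iff, hna, div_lt_iff₀ hn]
    rw [div_le_iff₀ hε] at hy2
    nlinarith, hsec τ hyY hre⟩
  have hq : ‖q₁ (Real.pi * I / τ)‖ = Real.exp (-Real.pi * τ.im) := by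
    rw [← norm_exp_I_mul, q₁]
    congr 2
    have : (Real.pi : ℂ) ≠ 0 := by exact_mod_cast hπ.ne'
    field_simp
    rw [I_sq]
  have harg : -exp (Real.pi * I * (1 - 1 / τ)) = exp (-(Real.pi * I / τ)) := by
    rw [show (Real.pi * I * (1 - 1 / τ) : ℂ) = Real.pi * I + -(Real.pi * I / τ) by ring, exp_add,
      exp_pi_mul_I]
    ring
  have h2 : ‖lift δ (1 - 1 / τ)‖ ≤
      C * ((Real.pi / ‖τ‖) ^ (-(1 / 2) : ℝ) * Real.exp (Real.pi / 12 * τ.im)) := by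
    rw [hna, hq, ← Real.exp_mul, norm_mul, Real.norm_of_nonneg (by positivity),
      Real.norm_of_nonneg (by positivity)] at h1
    rw [lift, norm_mul, norm_exp_I_mul, harg]
    have h3 : Real.exp (-(2 * Real.pi / 3) * (1 - 1 / τ).im) ≤ 1 := by
      rw [Real.exp_le_one_iff]
      nlinarith [mul_pos hπ (im_one_sub_inv_pos hy)]
    calc _ ≤ 1 * ‖δ (exp (-(Real.pi * I / τ)))‖ :=
          mul_le_mul_of_nonneg_right h3 (norm_nonneg _)
      _ ≤ _ := by
        rw [one_mul]
        refine h1.trans_eq ?_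
        congr 3; ring
  have h4 : ((Real.pi / ‖τ‖) ^ (-(1 / 2) : ℝ)) ^ 4 = ‖τ‖ ^ 2 / Real.pi ^ 2 := by
    rw [← Real.rpow_natCast, ← Real.rpow_mul (by positivity)]
    norm_num
    rw [inv_eq_one_div]
    field_simp
  calc ‖lift δ (1 - 1 / τ)‖ ^ 4 / ‖τ‖ ^ 2 ≤
      (C * ((Real.pi / ‖τ‖) ^ (-(1 / 2) : ℝ) * Real.exp (Real.pi / 12 * τ.im))) ^ 4 / ‖τ‖ ^ 2 := by
        gcongr
    _ = C ^ 4 / Real.pi ^ 2 * Real.exp (Real.pi / 12 * τ.im) ^ 4 := by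
      rw [mul_pow, mul_pow, h4]; field_simp
    _ = _ := by
      rw [← Real.exp_nat_mul]; congr 2; push_cast; ring

lemma exists_norm_liftNorm_le {θ₀ : ℝ} (hθ₀ : 0 < θ₀) {δ : ℂ → ℂ}
    (hδ : DifferentiableOn ℂ δ (ball 0 1)) (hg : GrowthBound θ₀ δ) :
    ∃ C Y : ℝ, 1 ≤ Y ∧ ∀ τ : ℂ, Y ≤ τ.im → |τ.re| ≤ 1 →
      ‖liftNorm δ τ‖ ≤ C * Real.exp (-(5 * Real.pi) * τ.im) := by
  obtain ⟨A, hA, h1⟩ := exists_norm_lift_le hδ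
  obtain ⟨C, Y, hC, hY, h2⟩ := exists_norm_lift_one_sub_inv_le hθ₀ hg
  refine ⟨A ^ 4 * A ^ 4 * C, Y, hY, fun τ hτ hre => ?_⟩
  rw [norm_liftNorm]
  have a1 := h1 τ (hY.trans hτ)
  have a2 := h1 (τ + 1) (by simpa using hY.trans hτ)
  have a3 := h2 τ hτ hre
  simp only [add_im, one_im, add_zero] at a2
  calc _ ≤ (A * Real.exp (-(2 * Real.pi / 3) * τ.im)) ^ 4 *
        (A * Real.exp (-(2 * Real.pi / 3) * τ.im)) ^ 4 *
        (C * Real.exp (Real.pi / 3 * τ.im)) := by gcongr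
    -- The exponents add up to -8π/3 - 8π/3 + π/3 = -5π.
    _ = A ^ 4 * A ^ 4 * C * (Real.exp (-(2 * Real.pi / 3) * τ.im) ^ 4 *
        Real.exp (-(2 * Real.pi / 3) * τ.im) ^ 4 * Real.exp (Real.pi / 3 * τ.im)) := by ring
    _ = _ := by
      rw [← Real.exp_nat_mul, ← Real.exp_add, ← Real.exp_add]
      congr 2; push_cast; ring

/-! ### Vanishing in weight six by the maximum principle -/

lemma cube_lt_exp_pi_mul {s : ℝ} (hs : 1 < s) : s ^ 3 < Real.exp (Real.pi * (s - 1)) := by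
  have h : s < Real.exp (Real.pi * (s - 1) / 3) := by
    have := Real.add_one_le_exp (Real.pi * (s - 1) / 3)
    nlinarith [Real.pi_gt_three]
  calc s ^ 3 < Real.exp (Real.pi * (s - 1) / 3) ^ 3 := by gcongr
    _ = _ := by rw [← Real.exp_nat_mul]; congr 1; push_cast; ring

/-- A form of weight six on the modular group whose order of vanishing at infinity exceeds one
vanishes identically: compare the maximum of `|P(τ) e^(-2πiτ)|` over `Im τ ≥ 1 / 2` with its value
at the inverted point. -/
lemma eq_zero_of_weight_six {P : ℂ → ℂ} (hd : DifferentiableOn ℂ P {τ | 0 < τ.im})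
    (hT : ∀ τ : ℂ, 0 < τ.im → ∀ n : ℤ, ‖P (τ + n)‖ = ‖P τ‖)
    (hS : ∀ τ : ℂ, 0 < τ.im → ‖P (-1 / τ)‖ = ‖τ‖ ^ 6 * ‖P τ‖) {C Y : ℝ}
    (hb : ∀ τ : ℂ, Y ≤ τ.im → |τ.re| ≤ 1 → ‖P τ‖ ≤ C * Real.exp (-(5 * Real.pi) * τ.im))
    {σ : ℂ} (hσ : 1 / 2 ≤ σ.im) : P σ = 0 := by
  by_contra hne
  have hπ := Real.pi_pos
  -- The extra factor has period one and grows only like e^(2π Im τ), so |Q| is still periodic and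
  -- decays like e^(-3π Im τ). Its supremum over Im τ ≥ 1/2 is thus attained on a compact rectangle.
  set Q : ℂ → ℂ := fun τ => P τ * exp ((-(2 * Real.pi) : ℝ) * I * τ) with hQ
  have nQ (τ : ℂ) : ‖Q τ‖ = ‖P τ‖ * Real.exp (2 * Real.pi * τ.im) := by
    rw [hQ]; simp only [norm_mul, norm_exp_I_mul, neg_neg]
  have hQT (τ : ℂ) (hτ : 0 < τ.im) (n : ℤ) : ‖Q (τ + n)‖ = ‖Q τ‖ := by
    rw [nQ, nQ, hT τ hτ]; simp
  have hQd : DifferentiableOn ℂ Q {τ | 0 < τ.im} := hd.mul (by fun_prop)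
  have hQσ : 0 < ‖Q σ‖ := by rw [nQ]; have := norm_pos_iff.2 hne; positivity
  have hdecay : ∃ Y' : ℝ, Y ≤ Y' ∧ 1 ≤ Y' ∧ ∀ τ : ℂ, Y' ≤ τ.im → |τ.re| ≤ 1 →
      ‖Q τ‖ < ‖Q σ‖ := by
    have : Tendsto (fun y : ℝ => C * Real.exp (-(3 * Real.pi * y))) atTop (𝓝 (C * 0)) :=
      (Real.tendsto_exp_neg_atTop_nhds_zero.comp
        (tendsto_id.const_mul_atTop (by positivity : 0 < 3 * Real.pi))).const_mul C
    rw [mul_zero] at this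
    obtain ⟨Z, hZ⟩ := eventually_atTop.1 (this.eventually (gt_mem_nhds hQσ))
    refine ⟨max Z (max Y 1), (le_max_left _ _).trans (le_max_right _ _),
      (le_max_right _ _).trans (le_max_right _ _), fun τ hτ hre => ?_⟩
    refine lt_of_le_of_lt ?_ (hZ τ.im ((le_max_left _ _).trans hτ))
    rw [nQ]
    calc _ ≤ C * Real.exp (-(5 * Real.pi) * τ.im) * Real.exp (2 * Real.pi * τ.im) := by
          gcongr
          exact hb τ (((le_max_left _ _).trans (le_max_right _ _)).trans hτ) hre
      _ = _ := by rw [mul_assoc, ← Real.exp_add]; congr 2; ring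
  obtain ⟨Y', -, hY1, hY'⟩ := hdecay
  have hK : IsCompact (Set.Icc (-(1 / 2) : ℝ) (1 / 2) ×ℂ Set.Icc (1 / 2 : ℝ) Y') :=
    isCompact_Icc.reProdIm isCompact_Icc
  have hKpos : (Set.Icc (-(1 / 2) : ℝ) (1 / 2) ×ℂ Set.Icc (1 / 2 : ℝ) Y') ⊆ {τ | 0 < τ.im} :=
    fun τ hτ => by have := hτ.2.1; exact lt_of_lt_of_le (by norm_num) this
  obtain ⟨τ₀, hτ₀, hmax⟩ := hK.exists_isMaxOn ⟨I / 2, by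
    rw [mem_reProdIm]; norm_num; linarith⟩ (hQd.continuousOn.mono hKpos).norm
  have hred (τ : ℂ) (hτ : 1 / 2 ≤ τ.im) : ∃ τ' : ℂ, ‖Q τ'‖ = ‖Q τ‖ ∧ |τ'.re| ≤ 1 / 2 ∧
      τ'.im = τ.im := by
    refine ⟨τ + ((-round τ.re : ℤ) : ℂ), hQT τ (by linarith) _, ?_, by simp⟩
    simpa [← sub_eq_add_neg] using abs_sub_round τ.re
  have hσ0 : ‖Q σ‖ ≤ ‖Q τ₀‖ := by
    obtain ⟨σ', h1, h2, h3⟩ := hred σ hσ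
    by_cases h : Y' ≤ σ'.im
    · have := hY' σ' h (by linarith)
      linarith
    · rw [← h1]
      exact hmax ⟨abs_le.1 h2, by rw [Set.mem_preimage, h3]; exact ⟨hσ, by linarith⟩⟩
  have hglob (τ : ℂ) (hτ : 1 / 2 ≤ τ.im) : ‖Q τ‖ ≤ ‖Q τ₀‖ := by
    obtain ⟨σ', h1, h2, h3⟩ := hred τ hτ
    rw [← h1]
    by_cases h : Y' ≤ σ'.im
    · have := hY' σ' h (by linarith)
      linarith
    · exact hmax ⟨abs_le.1 h2, by rw [Set.mem_preimage, h3]; exact ⟨hτ, by linarith⟩⟩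
  have hτ₀im : 1 / 2 ≤ τ₀.im := hτ₀.2.1
  -- On the lower edge |τ₀|² ≤ 1/2, so with s = 1/|τ₀|² > 1 the point -1/τ₀ has height s/2 and stays
  -- in the region. There |Q| is multiplied by s^(-3) e^(π(s-1)) > 1, against maximality. In the
  -- interior the maximum principle makes |Q| constant, against its decay.
  rcases hτ₀im.eq_or_lt with heq | hlt
  · have hpos : 0 < τ₀.im := by linarith
    have hn := normSq_pos.2 (ne_zero_of_im_pos hpos)
    have hns : normSq τ₀ = ‖τ₀‖ ^ 2 := normSq_eq_norm_sq τ₀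
    have hle : normSq τ₀ ≤ 1 / 2 := by
      rw [normSq_apply, ← heq]
      have := hτ₀.1
      rw [Set.mem_preimage, Set.mem_Icc] at this
      nlinarith
    have him : (-1 / τ₀).im = 1 / 2 * (1 / normSq τ₀) := by
      rw [neg_div, neg_im, one_div, inv_im, ← heq]; ring
    have hs : 1 < 1 / normSq τ₀ := by rw [lt_div_iff₀ hn]; linarith
    have h1 := hglob (-1 / τ₀) (by rw [him]; linarith)
    have h2 := cube_lt_exp_pi_mul hs
    rw [nQ, nQ, hS τ₀ hpos, him, ← heq, show ‖τ₀‖ ^ 6 = normSq τ₀ ^ 3 by rw [hns]; ring] at h1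
    have hP : 0 < ‖P τ₀‖ := by
      have : 0 < ‖Q τ₀‖ := hQσ.trans_le hσ0
      rw [nQ] at this
      exact pos_of_mul_pos_left this (Real.exp_nonneg _)
    have h3 : normSq τ₀ ^ 3 * Real.exp (2 * Real.pi * (1 / 2 * (1 / normSq τ₀))) ≤
        Real.exp (2 * Real.pi * (1 / 2)) := by
      refine le_of_mul_le_mul_left ?_ hP
      linarith
    rw [show 2 * Real.pi * (1 / 2 * (1 / normSq τ₀)) =
      Real.pi * (1 / normSq τ₀ - 1) + 2 * Real.pi * (1 / 2) by ring, Real.exp_add, ← mul_assoc] at h3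
    have h4 := le_of_mul_le_mul_right (h3.trans_eq (one_mul _).symm) (Real.exp_pos _)
    have h5 : normSq τ₀ ^ 3 * (1 / normSq τ₀) ^ 3 = 1 := by field_simp
    have h6 := mul_lt_mul_of_pos_left h2 (pow_pos hn 3)
    linarith
  · have hsub : {τ : ℂ | 1 / 2 < τ.im} ⊆ {τ | 0 < τ.im} := fun τ hτ => by
      simp only [Set.mem_ofPred_eq] at hτ ⊢; linarith
    have hconst := Complex.norm_eqOn_of_isPreconnected_of_isMaxOn (isPreconnected_im_gt (1 / 2))
      (isOpen_im_gt (1 / 2)) (hQd.mono hsub) hlt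
      (fun τ (hτ : 1 / 2 < τ.im) => hglob τ hτ.le)
    have hY1' : (1 : ℝ) / 2 < Y' := by linarith
    have h1 := hconst (x := (Y' : ℂ) * I) (by simpa using hY1')
    have h2 := hY' ((Y' : ℂ) * I) (by simp) (by simp)
    simp only [Function.comp_apply, Function.const_apply] at h1
    linarith

/-! ### Uniqueness -/

lemma eq_zero_of_eq_zero_on_ray {δ : ℂ → ℂ} (hδ : DifferentiableOn ℂ δ (ball 0 1)) {ε : ℂ}
    (hε : ‖ε‖ = 1) {a b : ℝ} (ha : 0 < a) (hab : a < b)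
    (h : ∀ t : ℝ, a < t → t < b → δ (ε * exp (-(t : ℂ))) = 0) : Set.EqOn δ 0 (ball 0 1) := by
  have hε0 : ε ≠ 0 := by rintro rfl; simp at hε
  refine eqOn_of_eq_on_curve (γ := fun t : ℝ => ε * exp (-(t : ℂ))) (t₀ := (a + b) / 2)
    isOpen_ball (convex_ball 0 1).isPreconnected hδ (differentiableOn_const 0) (by fun_prop)
    (fun s t hst => ?_) ?_ ?_
  · have := congrArg norm (mul_left_cancel₀ hε0 hst)
    simpa [norm_exp] using this
  · rw [mem_ball_zero_iff, norm_mul, hε, norm_exp]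
    simp; linarith
  · filter_upwards [Ioo_mem_nhds (show a < (a + b) / 2 by linarith)
      (show (a + b) / 2 < b by linarith)] with t ht
    exact h t ht.1 ht.2

/-- A holomorphic function on the disk that satisfies the homogeneous transformation law and the
growth bound vanishes. -/
lemma eqOn_zero_of_homogeneous {θ₀ : ℝ} (hθ₀ : 0 < θ₀) {δ : ℂ → ℂ}
    (hδ : DifferentiableOn ℂ δ (ball 0 1))
    (hlaw : ∀ α : ℝ, 0 < α → qPow (2 / 3) α * δ (-q α) =
      -(Real.sqrt (Real.pi / α) : ℂ) * q₁Pow (2 / 3) α * δ (-q₁ α))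
    (hg : GrowthBound θ₀ δ) : Set.EqOn δ 0 (ball 0 1) := by
  have hS : ∀ τ : ℂ, 0 < τ.im → lift δ (-1 / τ) ^ 2 = -I * τ * lift δ τ ^ 2 :=
    fun τ hτ => lift_neg_inv_sq hδ hlaw hτ
  obtain ⟨C, Y, -, hb⟩ := exists_norm_liftNorm_le hθ₀ hδ hg
  have hπ := Real.pi_pos
  have hzero (τ : ℂ) (hτ : 1 / 2 ≤ τ.im) : liftNorm δ τ = 0 :=
    eq_zero_of_weight_six (differentiableOn_liftNorm hδ)
      (fun τ hτ n => norm_liftNorm_add_intCast hS hτ n)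
      (fun τ hτ => norm_liftNorm_neg_inv hS hτ) hb hτ
  set U : Set ℂ := {τ | 1 / 2 < τ.im} with hU
  have hUo : IsOpen U := isOpen_im_gt _
  have hUc : IsPreconnected U := isPreconnected_im_gt _
  have hUpos : ∀ τ ∈ U, 0 < τ.im := fun τ (hτ : 1 / 2 < τ.im) => by linarith
  have hd := differentiableOn_lift hδ
  have d1 : DifferentiableOn ℂ (lift δ) U := hd.mono hUpos
  have d2 : DifferentiableOn ℂ (fun τ => lift δ (τ + 1)) U :=
    hd.comp (by fun_prop) fun τ hτ => by simpa using hUpos τ hτ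
  have d3 : DifferentiableOn ℂ (fun τ => lift δ (1 - 1 / τ)) U :=
    hd.comp (fun τ hτ => ((differentiableAt_const _).sub ((differentiableAt_const _).div
      differentiableAt_id (ne_zero_of_im_pos (hUpos τ hτ)))).differentiableWithinAt)
      fun τ hτ => im_one_sub_inv_pos (hUpos τ hτ)
  have hprod : ∀ τ ∈ U, lift δ τ * (lift δ (τ + 1) * lift δ (1 - 1 / τ)) = 0 := by
    intro τ hτ
    have h := hzero τ (le_of_lt hτ)
    have h0 := ne_zero_of_im_pos (hUpos τ hτ)
    simp only [liftNorm, mul_eq_zero, div_eq_zero_iff, pow_eq_zero_iff, ne_eq, OfNat.ofNat_ne_zero,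
      not_false_eq_true, h0, or_false] at h ⊢
    tauto
  have key (τ : ℂ) (h : lift δ τ = 0) : δ (-exp (Real.pi * I * τ)) = 0 := by
    simpa [lift, exp_ne_zero] using h
  have hmem (t : ℝ) (ht : 2 < t) : ((t / Real.pi : ℝ) : ℂ) * I ∈ U := by
    have : 1 / 2 < t / Real.pi := by
      rw [lt_div_iff₀ hπ]; linarith [Real.pi_lt_four]
    simpa [hU] using this
  have hπc : (Real.pi : ℂ) ≠ 0 := by exact_mod_cast hπ.ne'
  have eI (t : ℝ) : (Real.pi * I * (((t / Real.pi : ℝ) : ℂ) * I) : ℂ) = -t := by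
    push_cast; field_simp; rw [I_sq]; ring
  -- One of three analytic factors vanishes identically. On the imaginary axis this kills `δ` at
  -- -e^(-t) or at e^(-t) for t in an interval; the intervals are chosen so that τ = it/π, or τ =
  -- iπ/t for the third factor, has height above 1/2.
  rcases (d1.analyticOnNhd hUo).eq_zero_or_eq_zero_of_mul_eq_zero
    ((d2.mul d3).analyticOnNhd hUo) hprod hUc with h | h
  · refine eq_zero_of_eq_zero_on_ray hδ (ε := -1) (by simp) (a := 2) (b := 3) (by norm_num)
      (by norm_num) fun t ht _ => ?_
    have := key _ (h _ (hmem t ht))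
    rwa [eI, ← neg_one_mul] at this
  rcases (d2.analyticOnNhd hUo).eq_zero_or_eq_zero_of_mul_eq_zero
    (d3.analyticOnNhd hUo) h hUc with h | h
  · refine eq_zero_of_eq_zero_on_ray hδ (ε := 1) (by simp) (a := 2) (b := 3) (by norm_num)
      (by norm_num) fun t ht _ => ?_
    have := key _ (h _ (hmem t ht))
    rw [mul_add, eI, exp_add, mul_one, exp_pi_mul_I] at this
    simpa using this
  · refine eq_zero_of_eq_zero_on_ray hδ (ε := 1) (by simp) (a := 1) (b := 2) (by norm_num)
      (by norm_num) fun t ht ht' => ?_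
    have htc : (t : ℂ) ≠ 0 := by
      have : t ≠ 0 := by linarith
      exact_mod_cast this
    have hm : ((Real.pi / t : ℝ) : ℂ) * I ∈ U := by
      have : 1 / 2 < Real.pi / t := by
        rw [lt_div_iff₀ (by linarith)]; linarith [Real.pi_gt_three]
      simpa [hU] using this
    have := key _ (h _ hm)
    rw [show (Real.pi * I * (1 - 1 / (((Real.pi / t : ℝ) : ℂ) * I)) : ℂ) = Real.pi * I + -t by
      push_cast; field_simp; ring, exp_add, exp_pi_mul_I] at this
    simpa using this

/-- Two solutions agree on the unit disk. -/
lemma IsSolution.eqOn {θ₀ : ℝ} (hθ₀ : 0 < θ₀) {ω ω' : ℂ → ℂ} (h : IsSolution θ₀ ω)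
    (h' : IsSolution θ₀ ω') : Set.EqOn ω' ω (ball 0 1) := by
  have := eqOn_zero_of_homogeneous hθ₀ (δ := fun z => ω' z - ω z) (h'.holomorphic.sub h.holomorphic)
    (fun α hα => by linear_combination h'.law α hα - h.law α hα) (h'.growth.sub h.growth)
  exact fun z hz => sub_eq_zero.1 (this hz)

/-! ### Euler's product, η and its inversion -/

/-- Euler's product `∏ (1 - x ^ (n + 1))`. -/
noncomputable def euler (x : ℂ) : ℂ := ∏' n : ℕ, (1 - x ^ (n + 1))

lemma differentiableOn_euler : DifferentiableOn ℂ euler (ball 0 1) :=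
  ModularForm.differentiableOn_tprod_one_sub_pow

lemma pow_ne_one_of_norm_lt {x : ℂ} (hx : ‖x‖ < 1) {n : ℕ} (hn : n ≠ 0) : 1 - x ^ n ≠ 0 := by
  rw [sub_ne_zero]
  intro h
  have := congrArg norm h
  rw [norm_one, norm_pow] at this
  exact (pow_lt_one₀ (norm_nonneg x) hx hn).ne this.symm

lemma euler_ne_zero {x : ℂ} (hx : ‖x‖ < 1) : euler x ≠ 0 := by
  have := tprod_one_add_ne_zero_of_summable (f := fun n : ℕ => -x ^ (n + 1))
    (fun n => by simpa [← sub_eq_add_neg] using pow_ne_one_of_norm_lt hx n.succ_ne_zero)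
    (by simpa using (summable_nat_add_iff 1).2 (summable_geometric_of_lt_one (norm_nonneg x) hx))
  simpa [euler, sub_eq_add_neg] using this

/-- The Dedekind eta function in the variable `α`, where `τ = iα/π`. -/
noncomputable def etaExp (α : ℂ) : ℂ := exp (-α / 12) * euler (exp (-(2 * α)))

lemma etaExp_eq_eta (α : ℂ) : etaExp α = ModularForm.eta (I * α / Real.pi) := by
  have hπ : (Real.pi : ℂ) ≠ 0 := by exact_mod_cast Real.pi_ne_zero
  have h1 : exp (-α / 12) = Function.Periodic.qParam 24 (I * α / Real.pi) := by
    rw [Function.Periodic.qParam]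
    congr 1; push_cast; field_simp
    linear_combination (-24 * α) * I_sq
  have h2 : exp (-(2 * α)) = Function.Periodic.qParam 1 (I * α / Real.pi) := by
    rw [Function.Periodic.qParam]
    congr 1; push_cast; field_simp
    linear_combination (-α) * I_sq
  rw [etaExp, euler, ModularForm.eta, h1, h2]

lemma etaExp_pi_sq_div {α : ℂ} (hα : 0 < α.re) :
    etaExp (Real.pi ^ 2 / α) = I.sqrt⁻¹ * ((I * α / Real.pi).sqrt * etaExp α) := by
  have hπ : (Real.pi : ℂ) ≠ 0 := by exact_mod_cast Real.pi_ne_zero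
  have hα0 : α ≠ 0 := by rintro rfl; simp at hα
  have hmem : I * α / Real.pi ∈ UpperHalfPlane.upperHalfPlaneSet := by
    show 0 < (I * α / Real.pi).im
    rw [div_ofReal_im]
    simpa using div_pos hα Real.pi_pos
  have := ModularForm.eta_comp_eq_csqrt_I_inv hmem
  simp only [Function.comp_apply, Pi.smul_apply, Pi.mul_apply, smul_eq_mul] at this
  rw [etaExp_eq_eta, etaExp_eq_eta, ← this]
  congr 1
  field_simp
  rw [I_sq]

lemma norm_etaExp_pi_sq_div {α : ℂ} (hα : 0 < α.re) :
    ‖etaExp (Real.pi ^ 2 / α)‖ = (‖α‖ / Real.pi) ^ (1 / 2 : ℝ) * ‖etaExp α‖ := by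
  have hs (z : ℂ) : ‖z.sqrt‖ = ‖z‖ ^ (1 / 2 : ℝ) := by
    rw [Complex.sqrt, show (2⁻¹ : ℂ) = ((1 / 2 : ℝ) : ℂ) by norm_num]
    exact norm_cpow_real z (1 / 2)
  rw [etaExp_pi_sq_div hα, norm_mul, norm_mul, norm_inv, hs, hs]
  simp [abs_of_pos Real.pi_pos]

lemma etaExp_pi_sq_div_ofReal {α : ℝ} (hα : 0 < α) :
    etaExp (Real.pi ^ 2 / α : ℝ) = (Real.sqrt (α / Real.pi) : ℂ) * etaExp α := by
  have h := etaExp_pi_sq_div (α := α) (by simpa using hα)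
  have hI : I.sqrt ≠ 0 := by
    rw [Complex.sqrt]; simp [cpow_eq_zero_iff]
  have hs : (I * α / Real.pi).sqrt = (Real.sqrt (α / Real.pi) : ℂ) * I.sqrt := by
    have hr : 0 < α / Real.pi := div_pos hα Real.pi_pos
    have hr0 : ((α / Real.pi : ℝ) : ℂ) ≠ 0 := by exact_mod_cast hr.ne'
    have e : (I * α / Real.pi : ℂ) = ((α / Real.pi : ℝ) : ℂ) * I := by push_cast; ring
    rw [Complex.sqrt, Complex.sqrt, e, cpow_def_of_ne_zero (mul_ne_zero hr0 I_ne_zero),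
      log_ofReal_mul hr I_ne_zero, add_mul, exp_add, cpow_def_of_ne_zero I_ne_zero,
      Real.sqrt_eq_rpow, ofReal_cpow hr.le, cpow_def_of_ne_zero hr0, ofReal_log hr.le]
    norm_num
  push_cast
  rw [h, hs]
  field_simp

/-! ### The mock theta function and its holomorphy -/

/-- The numerator series of `ω`. -/
noncomputable def numer (z : ℂ) : ℂ :=
  ∑' n : ℕ, (-1) ^ n * (z ^ (3 * n * (n + 1)) * ((1 + z ^ (2 * n + 1)) / (1 - z ^ (2 * n + 1))))

/-- The third order mock theta function `ω`. -/
noncomputable def omega (z : ℂ) : ℂ := numer z / euler (z ^ 2)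

lemma norm_one_add_div_one_sub_le {z : ℂ} {r : ℝ} (hz : ‖z‖ ≤ r) (hr : r < 1) (n : ℕ) :
    ‖(1 + z ^ (2 * n + 1)) / (1 - z ^ (2 * n + 1))‖ ≤ 2 / (1 - r) := by
  have h1 : ‖z ^ (2 * n + 1)‖ ≤ r := by
    rw [norm_pow]
    exact (pow_le_of_le_one (norm_nonneg z) (hz.trans hr.le) (by simp)).trans hz
  rw [norm_div]
  refine div_le_div₀ zero_le_two ?_ (by linarith) ?_
  · calc _ ≤ ‖(1 : ℂ)‖ + ‖z ^ (2 * n + 1)‖ := norm_add_le _ _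
      _ ≤ 2 := by rw [norm_one]; linarith
  · calc 1 - r ≤ ‖(1 : ℂ)‖ - ‖z ^ (2 * n + 1)‖ := by rw [norm_one]; linarith
      _ ≤ _ := norm_sub_norm_le _ _

lemma norm_numer_term_le {z : ℂ} {r : ℝ} (hz : ‖z‖ ≤ r) (hr : r < 1) (n : ℕ) :
    ‖(-1) ^ n * (z ^ (3 * n * (n + 1)) * ((1 + z ^ (2 * n + 1)) / (1 - z ^ (2 * n + 1))))‖ ≤
      r ^ n * (2 / (1 - r)) := by
  have hr0 : 0 ≤ r := (norm_nonneg z).trans hz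
  rw [norm_mul, norm_pow, norm_neg, norm_one, one_pow, one_mul, norm_mul]
  gcongr
  · rw [norm_pow]
    calc ‖z‖ ^ (3 * n * (n + 1)) ≤ r ^ (3 * n * (n + 1)) := by gcongr
      _ ≤ r ^ n := pow_le_pow_of_le_one hr0 hr.le (by nlinarith)
  · exact norm_one_add_div_one_sub_le hz hr n

lemma summable_numer_bound {r : ℝ} (h0 : 0 ≤ r) (hr : r < 1) :
    Summable fun n : ℕ => r ^ n * (2 / (1 - r)) :=
  (summable_geometric_of_lt_one h0 hr).mul_right _

lemma differentiableOn_numer : DifferentiableOn ℂ numer (ball 0 1) := by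
  intro z hz
  rw [mem_ball_zero_iff] at hz
  obtain ⟨r, hr1, hr2⟩ := exists_between hz
  have : DifferentiableOn ℂ numer (ball 0 r) := by
    refine differentiableOn_tsum_of_summable_norm
      (summable_numer_bound ((norm_nonneg z).trans hr1.le) hr2) (fun n w hw => ?_) isOpen_ball
      fun n w hw => norm_numer_term_le (mem_ball_zero_iff.1 hw).le hr2 n
    have := pow_ne_one_of_norm_lt ((mem_ball_zero_iff.1 hw).trans hr2) (n := 2 * n + 1) (by simp)
    exact DifferentiableAt.differentiableWithinAt (by fun_prop (disch := assumption))
  exact (this.differentiableAt (isOpen_ball.mem_nhds (by simpa using hr1))).differentiableWithinAt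

lemma differentiableOn_omega : DifferentiableOn ℂ omega (ball 0 1) := by
  have hsq (z : ℂ) (hz : z ∈ ball (0 : ℂ) 1) : ‖z ^ 2‖ < 1 := by
    rw [norm_pow]; exact pow_lt_one₀ (norm_nonneg z) (mem_ball_zero_iff.1 hz) two_ne_zero
  exact differentiableOn_numer.div (differentiableOn_euler.comp (by fun_prop)
    fun z hz => mem_ball_zero_iff.2 (hsq z hz)) fun z hz => euler_ne_zero (hsq z hz)

/-! ### Growth -/

/-- An alternating sum is bounded by the total variation of its terms. -/
lemma norm_tsum_alternating_le {b : ℕ → ℂ} (hb : Summable fun n => (-1) ^ n * b n) {v : ℕ → ℝ}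
    (hv : Summable v) (h : ∀ n, ‖b n - b (n + 1)‖ ≤ v n) :
    2 * ‖∑' n, (-1) ^ n * b n‖ ≤ ‖b 0‖ + ∑' n, v n := by
  have h1 : ∑' n, (-1) ^ n * b n = b 0 - ∑' n, (-1) ^ n * b (n + 1) := by
    rw [hb.tsum_eq_zero_add, sub_eq_add_neg, ← tsum_neg]
    simp [pow_succ]
  have hb' : Summable fun n => (-1) ^ n * b (n + 1) := by
    refine (((summable_nat_add_iff 1).2 hb).neg).congr fun n => ?_
    simp [pow_succ]
  have h2 : 2 * ∑' n, (-1) ^ n * b n = b 0 + ∑' n, (-1) ^ n * (b n - b (n + 1)) := by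
    simp_rw [mul_sub]
    rw [hb.tsum_sub hb']
    linear_combination h1
  have h3 : ‖∑' n, (-1) ^ n * (b n - b (n + 1))‖ ≤ ∑' n, v n :=
    tsum_of_norm_bounded hv.hasSum fun n => by simpa using h n
  calc 2 * ‖∑' n, (-1) ^ n * b n‖ = ‖2 * ∑' n, (-1) ^ n * b n‖ := by simp
    _ ≤ _ := by rw [h2]; exact (norm_add_le _ _).trans (by gcongr)

lemma norm_one_sub_pow_le {w : ℂ} (hw : ‖w‖ ≤ 1) (m : ℕ) : ‖1 - w ^ m‖ ≤ m * ‖1 - w‖ := by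
  have : 1 - w ^ m = (∑ i ∈ Finset.range m, w ^ i) * (1 - w) := by
    linear_combination geom_sum_mul w m
  rw [this, norm_mul]
  gcongr
  calc _ ≤ ∑ i ∈ Finset.range m, ‖w ^ i‖ := norm_sum_le _ _
    _ ≤ ∑ i ∈ Finset.range m, 1 := by
      refine Finset.sum_le_sum fun i _ => ?_
      rw [norm_pow]
      exact pow_le_one₀ (norm_nonneg w) hw
    _ = m := by simp

/-- The factor `m + 1` is kept for summability; the loss `‖w‖ ^ m` is paid for by the quadratic
powers of w in the numerator series. -/
lemma le_norm_one_sub_pow {w : ℂ} (hw : ‖w‖ ≤ 1) (m : ℕ) :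
    (m + 1) * (1 - ‖w‖) * ‖w‖ ^ m ≤ ‖1 - w ^ (m + 1)‖ := by
  have h1 : 1 - ‖w‖ ^ (m + 1) = (∑ i ∈ Finset.range (m + 1), ‖w‖ ^ i) * (1 - ‖w‖) := by
    linear_combination geom_sum_mul ‖w‖ (m + 1)
  have h2 : ((m : ℝ) + 1) * ‖w‖ ^ m ≤ ∑ i ∈ Finset.range (m + 1), ‖w‖ ^ i := by
    calc ((m : ℝ) + 1) * ‖w‖ ^ m = ∑ i ∈ Finset.range (m + 1), ‖w‖ ^ m := by simp
      _ ≤ _ := by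
        refine Finset.sum_le_sum fun i hi => ?_
        exact pow_le_pow_of_le_one (norm_nonneg w) hw (by simp at hi; omega)
  calc (m + 1) * (1 - ‖w‖) * ‖w‖ ^ m = ((m + 1) * ‖w‖ ^ m) * (1 - ‖w‖) := by ring
    _ ≤ 1 - ‖w‖ ^ (m + 1) := by rw [h1]; gcongr
    _ = ‖(1 : ℂ)‖ - ‖w ^ (m + 1)‖ := by simp
    _ ≤ _ := norm_sub_norm_le _ _

/-- In a Stolz angle |1 - w| is comparable to 1 - |w|, and this is O(1/(1 - |w|)). Using the
alternating signs matters: absolute values term by term would cost a logarithm. -/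
lemma norm_numer_le : ∃ S : ℝ, 0 ≤ S ∧ ∀ w : ℂ, 0 < ‖w‖ → ‖w‖ < 1 →
    ‖numer w‖ ≤ 1 / (1 - ‖w‖) + S * ‖1 - w‖ / (1 - ‖w‖) ^ 2 := by
  have hS : Summable fun n : ℕ => 1 / ((n : ℝ) + 1) ^ 2 := by
    have := (summable_nat_add_iff 1).2 (Real.summable_one_div_nat_pow.2 one_lt_two)
    simpa using this
  refine ⟨6 + 2 * ∑' n : ℕ, 1 / ((n : ℝ) + 1) ^ 2, by positivity, fun w hw0 hw => ?_⟩
  set r := ‖w‖ with hr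
  set κ := 1 - r with hκ
  have hκ0 : 0 < κ := by linarith
  set b : ℕ → ℂ := fun n => w ^ (3 * n * (n + 1)) * ((1 + w ^ (2 * n + 1)) / (1 - w ^ (2 * n + 1)))
    with hb
  have hsum : Summable fun n => (-1) ^ n * b n :=
    (summable_numer_bound hw0.le hw).of_norm_bounded fun n => norm_numer_term_le le_rfl hw n
  set v : ℕ → ℝ := fun n => 12 * ‖1 - w‖ / κ * r ^ n +
    4 * ‖1 - w‖ / κ ^ 2 * (1 / ((n : ℝ) + 1) ^ 2) with hv
  have hgeo := summable_geometric_of_lt_one hw0.le hw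
  have hvs : Summable v := (hgeo.mul_left _).add (hS.mul_left _)
  have hlow (n : ℕ) : ((n : ℝ) + 1) * κ * r ^ (2 * n) ≤ ‖1 - w ^ (2 * n + 1)‖ := by
    refine le_trans ?_ (le_norm_one_sub_pow hw.le (2 * n))
    gcongr; linarith [(Nat.cast_nonneg n : (0 : ℝ) ≤ n)]
  have hw2 (m : ℕ) : ‖w ^ m‖ ≤ 1 := by rw [norm_pow]; exact pow_le_one₀ hw0.le hw.le
  have hvar (n : ℕ) : ‖b n - b (n + 1)‖ ≤ v n := by
    have hn1 := pow_ne_one_of_norm_lt hw (n := 2 * n + 1) (by simp)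
    have hn2 := pow_ne_one_of_norm_lt hw (n := 2 * n + 3) (by simp)
    -- Discrete product rule: first the power of w varies, then the quotient. The two parts give the
    -- geometric and the inverse square part of `v`.
    have e : b n - b (n + 1) =
        w ^ (3 * n * (n + 1)) * (1 - w ^ (6 * (n + 1))) *
          ((1 + w ^ (2 * n + 1)) / (1 - w ^ (2 * n + 1))) +
        w ^ (3 * n * (n + 1) + 6 * (n + 1)) *
          (2 * w ^ (2 * n + 1) * (1 - w ^ 2) /
            ((1 - w ^ (2 * n + 1)) * (1 - w ^ (2 * n + 3)))) := by
      simp only [hb]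
      rw [show 2 * (n + 1) + 1 = 2 * n + 3 by ring, show 3 * (n + 1) * (n + 1 + 1) =
        3 * n * (n + 1) + 6 * (n + 1) by ring]
      field_simp
      ring
    rw [e]
    refine (norm_add_le _ _).trans (add_le_add ?_ ?_)
    · rw [norm_mul, norm_mul, norm_div, norm_pow, mul_div_assoc', div_le_iff₀ (norm_pos_iff.2 hn1)]
      have h1 : ‖1 - w ^ (6 * (n + 1))‖ ≤ 6 * (n + 1) * ‖1 - w‖ := by
        simpa using norm_one_sub_pow_le hw.le (6 * (n + 1))
      have h2 : ‖1 + w ^ (2 * n + 1)‖ ≤ 2 :=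
        (norm_add_le _ _).trans (by rw [norm_one]; linarith [hw2 (2 * n + 1)])
      have h3 : r ^ (3 * n * (n + 1)) ≤ r ^ n * r ^ (2 * n) := by
        rw [← pow_add]; exact pow_le_pow_of_le_one hw0.le hw.le (by nlinarith)
      calc _ ≤ (r ^ n * r ^ (2 * n)) * (6 * (n + 1) * ‖1 - w‖) * 2 := by gcongr
        _ = 12 * ‖1 - w‖ / κ * r ^ n * (((n : ℝ) + 1) * κ * r ^ (2 * n)) := by
          field_simp; ring
        _ ≤ _ := by gcongr; exact hlow n
    · have hp : 0 < ‖1 - w ^ (2 * n + 1)‖ * ‖1 - w ^ (2 * n + 3)‖ :=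
        mul_pos (norm_pos_iff.2 hn1) (norm_pos_iff.2 hn2)
      rw [norm_mul, norm_div, norm_mul, norm_mul, norm_mul, norm_pow, mul_div_assoc',
        div_le_iff₀ hp]
      have h1 : ‖1 - w ^ 2‖ ≤ 2 * ‖1 - w‖ := by simpa using norm_one_sub_pow_le hw.le 2
      have h3 : r ^ (3 * n * (n + 1) + 6 * (n + 1)) ≤ r ^ (2 * n) * r ^ (2 * (n + 1)) := by
        rw [← pow_add]; exact pow_le_pow_of_le_one hw0.le hw.le (by nlinarith)
      have hl1 := hlow n
      have hl2 := hlow (n + 1)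
      rw [show 2 * (n + 1) + 1 = 2 * n + 3 by ring] at hl2
      calc _ ≤ (r ^ (2 * n) * r ^ (2 * (n + 1))) * (2 * 1 * (2 * ‖1 - w‖)) := by
            gcongr
            · simp
            · exact hw2 _
        _ = 4 * ‖1 - w‖ / κ ^ 2 * (1 / ((n : ℝ) + 1) ^ 2) *
            ((((n : ℝ) + 1) * κ * r ^ (2 * n)) * (((n : ℝ) + 1) * κ * r ^ (2 * (n + 1)))) := by
          field_simp; ring
        _ ≤ _ := by
          gcongr
          refine le_trans ?_ hl2
          gcongr; linarith
  have hmain := norm_tsum_alternating_le hsum hvs hvar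
  have hb0 : ‖b 0‖ ≤ 2 / κ := by
    simpa [hb] using norm_one_add_div_one_sub_le (le_refl ‖w‖) hw 0
  have hvt : ∑' n, v n = 12 * ‖1 - w‖ / κ * κ⁻¹ +
      4 * ‖1 - w‖ / κ ^ 2 * ∑' n : ℕ, 1 / ((n : ℝ) + 1) ^ 2 := by
    rw [(hgeo.mul_left _).tsum_add (hS.mul_left _), tsum_mul_left, tsum_mul_left,
      tsum_geometric_of_lt_one hw0.le hw]
  rw [hvt] at hmain
  have : 1 / κ + (6 + 2 * ∑' n : ℕ, 1 / ((n : ℝ) + 1) ^ 2) * ‖1 - w‖ / κ ^ 2 =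
      (2 / κ + (12 * ‖1 - w‖ / κ * κ⁻¹ +
        4 * ‖1 - w‖ / κ ^ 2 * ∑' n : ℕ, 1 / ((n : ℝ) + 1) ^ 2)) / 2 := by
    field_simp; ring
  rw [this]
  have : numer w = ∑' n, (-1) ^ n * b n := rfl
  rw [this]
  linarith

lemma cos_mul_norm_le_re {θ₀ : ℝ} (hθ₀' : θ₀ < Real.pi / 2) {a : ℂ} (ha : a ∈ sector θ₀) :
    Real.cos θ₀ * ‖a‖ ≤ a.re := by
  have hn : 0 < ‖a‖ := norm_pos_iff.2 ha.1
  have h := Real.cos_le_cos_of_nonneg_of_le_pi (abs_nonneg _) (by linarith [Real.pi_pos]) ha.2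
  rwa [Real.cos_abs, cos_arg ha.1, le_div_iff₀ hn] at h

lemma exists_le_norm_euler : ∃ ρ : ℝ, 0 < ρ ∧ ∀ x : ℂ, ‖x‖ < ρ → 1 / 2 ≤ ‖euler x‖ := by
  have hc : ContinuousAt euler 0 :=
    (differentiableOn_euler.differentiableAt (isOpen_ball.mem_nhds (by simp))).continuousAt
  have h0 : euler 0 = 1 := by simp [euler]
  obtain ⟨ρ, hρ, h⟩ := Metric.eventually_nhds_iff.1
    (hc.norm.eventually (lt_mem_nhds (show (1 / 2 : ℝ) < ‖euler 0‖ by rw [h0]; norm_num)))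
  exact ⟨ρ, hρ, fun x hx => (h (by simpa using hx)).le⟩

lemma half_le_one_sub_exp_neg {s : ℝ} (h0 : 0 ≤ s) (h1 : s ≤ 1) : s / 2 ≤ 1 - Real.exp (-s) := by
  have h : Real.exp (-s) ≤ 1 / (1 + s) := by
    rw [Real.exp_neg, ← one_div]
    exact one_div_le_one_div_of_le (by linarith) (by linarith [Real.add_one_le_exp s])
  have : 1 / (1 + s) ≤ 1 - s / 2 := by
    rw [div_le_iff₀ (by linarith)]; nlinarith
  linarith

/-- The numerator is O(1/|α|) because Re α ≥ cos θ₀ |α|. As α → 0 the dual point of Euler's product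
tends to 0, where the product is near 1, and inversion of η carries this back to a lower bound at
q². -/
lemma growthBound_omega {θ₀ : ℝ} (hθ₀ : 0 < θ₀) (hθ₀' : θ₀ < Real.pi / 2) :
    GrowthBound θ₀ omega := by
  have hπ := Real.pi_pos
  set c := Real.cos θ₀ with hc
  have hc0 : 0 < c := Real.cos_pos_of_mem_Ioo ⟨by linarith, hθ₀'⟩
  obtain ⟨ρ, hρ, heul⟩ := exists_le_norm_euler
  obtain ⟨S, hS, hnum⟩ := norm_numer_le
  set K := 2 / c + S * 8 / c ^ 2 with hK
  refine IsBigO.of_bound (2 * K / Real.pi ^ (1 / 2 : ℝ)) ?_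
  -- The second entry gives 2B > 1/ρ, hence e^(-2B) < ρ, where B = Re(π²/α).
  have hε : 0 < min 1 (2 * Real.pi ^ 2 * c * ρ) := by positivity
  rw [Metric.nhdsWithin_basis_ball.eventually_iff]
  refine ⟨_, hε, fun a ha => ?_⟩
  obtain ⟨hball, hsec⟩ := ha
  rw [mem_ball_zero_iff, lt_min_iff] at hball
  obtain ⟨ha1, ha2⟩ := hball
  have hn : 0 < ‖a‖ := norm_pos_iff.2 hsec.1
  have hre := cos_mul_norm_le_re hθ₀' hsec
  rw [← hc] at hre
  have hs0 : 0 < a.re := lt_of_lt_of_le (by positivity) hre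
  have hs1 : a.re ≤ 1 := (re_le_norm a).trans ha1.le
  have hw : ‖exp (-a)‖ = Real.exp (-a.re) := by rw [norm_exp, neg_re]
  have hw1 : ‖exp (-a)‖ < 1 := by rw [hw, Real.exp_lt_one_iff]; linarith
  have hκ : c * ‖a‖ / 2 ≤ 1 - ‖exp (-a)‖ := by
    rw [hw]
    linarith [half_le_one_sub_exp_neg hs0.le hs1]
  have hw2 : ‖1 - exp (-a)‖ ≤ 2 * ‖a‖ := by
    rw [norm_sub_rev]
    simpa using norm_exp_sub_one_le (x := -a) (by simpa using ha1.le)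
  have hN : ‖numer (exp (-a))‖ ≤ K / ‖a‖ := by
    have hcn : 0 < c * ‖a‖ / 2 := by positivity
    calc _ ≤ _ := hnum _ (by simp) hw1
      _ ≤ 1 / (c * ‖a‖ / 2) + S * (2 * ‖a‖) / (c * ‖a‖ / 2) ^ 2 := by gcongr
      _ = K / ‖a‖ := by rw [hK]; field_simp; ring
  set B := (Real.pi ^ 2 / a : ℂ).re with hB
  have hBeq : B = Real.pi ^ 2 * a.re / ‖a‖ ^ 2 := by
    rw [hB, ← ofReal_pow, div_eq_mul_inv, re_ofReal_mul, inv_re, normSq_eq_norm_sq, mul_div_assoc]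
  have hBlow : Real.pi ^ 2 * c / ‖a‖ ≤ B := by
    rw [hBeq, div_le_div_iff₀ hn (by positivity)]
    nlinarith [mul_le_mul_of_nonneg_left hre (by positivity : 0 ≤ Real.pi ^ 2 * ‖a‖)]
  have hx : ‖exp (-(2 * (Real.pi ^ 2 / a : ℂ)))‖ < ρ := by
    have h1 : ‖exp (-(2 * (Real.pi ^ 2 / a : ℂ)))‖ = Real.exp (-(2 * B)) := by
      rw [norm_exp, neg_re, show (2 : ℂ) = ((2 : ℝ) : ℂ) by simp, re_ofReal_mul]
    have hp : 0 < 2 * B := by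
      have : 0 < Real.pi ^ 2 * c / ‖a‖ := by positivity
      linarith
    rw [h1, Real.exp_neg, inv_lt_comm₀ (Real.exp_pos _) hρ]
    have h2 : ρ⁻¹ < 2 * (Real.pi ^ 2 * c / ‖a‖) := by
      rw [inv_eq_one_div, mul_div_assoc', div_lt_div_iff₀ hρ hn]; linarith
    linarith [Real.add_one_le_exp (2 * B)]
  have hE : 1 / 2 * Real.exp (-B / 12) ≤ (‖a‖ / Real.pi) ^ (1 / 2 : ℝ) * ‖euler (exp (-a) ^ 2)‖ := by
    have h1 : ‖etaExp (Real.pi ^ 2 / a)‖ =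
        Real.exp (-B / 12) * ‖euler (exp (-(2 * (Real.pi ^ 2 / a : ℂ))))‖ := by
      rw [etaExp, norm_mul, norm_exp, show (12 : ℂ) = ((12 : ℝ) : ℂ) by simp, div_ofReal_re, neg_re]
    have h2 : ‖etaExp a‖ ≤ ‖euler (exp (-a) ^ 2)‖ := by
      rw [etaExp, norm_mul, ← exp_nat_mul]
      have : ‖exp (-a / 12)‖ ≤ 1 := by
        rw [norm_exp, Real.exp_le_one_iff, show (12 : ℂ) = ((12 : ℝ) : ℂ) by simp, div_ofReal_re,
          neg_re]
        linarith
      calc _ ≤ 1 * _ := mul_le_mul_of_nonneg_right this (norm_nonneg _)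
        _ = _ := by rw [one_mul]; congr 3; push_cast; ring
    calc 1 / 2 * Real.exp (-B / 12) ≤
        ‖euler (exp (-(2 * (Real.pi ^ 2 / a : ℂ))))‖ * Real.exp (-B / 12) := by
          gcongr; exact heul _ hx
      _ = (‖a‖ / Real.pi) ^ (1 / 2 : ℝ) * ‖etaExp a‖ := by
        rw [mul_comm, ← h1, norm_etaExp_pi_sq_div hs0]
      _ ≤ _ := by gcongr
  have hq : ‖q₁ a‖ ^ (-(1 / 12) : ℝ) = Real.exp (B / 12) := by
    rw [q₁, norm_exp, neg_re, ← hB, ← Real.exp_mul]; congr 1; ring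
  have hEpos : 0 < ‖euler (exp (-a) ^ 2)‖ := norm_pos_iff.2 (euler_ne_zero (by
    rw [norm_pow]; exact pow_lt_one₀ (norm_nonneg _) hw1 two_ne_zero))
  rw [hq, Real.norm_of_nonneg (by positivity), omega, norm_div, div_le_iff₀ hEpos]
  have hpow : (‖a‖ / Real.pi) ^ (1 / 2 : ℝ) = ‖a‖ ^ (1 / 2 : ℝ) / Real.pi ^ (1 / 2 : ℝ) :=
    Real.div_rpow hn.le hπ.le _
  have hsq : ‖a‖ ^ (-(1 / 2) : ℝ) = ‖a‖ ^ (1 / 2 : ℝ) / ‖a‖ := by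
    rw [← Real.rpow_sub_one hn.ne']; norm_num
  have hexp : Real.exp (-B / 12) * Real.exp (B / 12) = 1 := by
    rw [← Real.exp_add, neg_div, neg_add_cancel, Real.exp_zero]
  have hK0 : 0 ≤ K := by positivity
  calc _ ≤ K / ‖a‖ := hN
    _ = 2 * K / ‖a‖ * (1 / 2 * Real.exp (-B / 12)) * Real.exp (B / 12) := by
      rw [mul_assoc, mul_assoc, hexp]; ring
    _ ≤ 2 * K / ‖a‖ * ((‖a‖ / Real.pi) ^ (1 / 2 : ℝ) * ‖euler (exp (-a) ^ 2)‖) *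
        Real.exp (B / 12) := by gcongr
    _ = _ := by rw [hpow, hsq]; ring

end MockThree

namespace MockThree

open Complex MeasureTheory

/-! ### Contour shifts and bounds for hyperbolic functions -/

/-- Shifting a line of integration in a strip. -/
lemma integral_eq_integral_add_mul_I {f : ℂ → ℂ} {c : ℝ} (hc : 0 ≤ c)
    (hd : DifferentiableOn ℂ f (Set.univ ×ℂ Set.Icc 0 c))
    (h0 : Integrable fun x : ℝ => f x) (h1 : Integrable fun x : ℝ => f (x + c * I)) {b : ℝ → ℝ}
    (hb : Tendsto b atTop (𝓝 0))
    (hbd : ∀ᶠ x : ℝ in atTop, ∀ y ∈ Set.Icc 0 c,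
      ‖f (x + y * I)‖ ≤ b x ∧ ‖f (-x + y * I)‖ ≤ b x) :
    ∫ x : ℝ, f x = ∫ x : ℝ, f (x + c * I) := by
  have hrect (R : ℝ) : (∫ x : ℝ in -R..R, f x) - (∫ x : ℝ in -R..R, f (x + c * I)) =
      I * (∫ y : ℝ in (0 : ℝ)..c, f (-R + y * I)) - I * (∫ y : ℝ in (0 : ℝ)..c, f (R + y * I)) := by
    have := integral_boundary_rect_eq_zero_of_differentiableOn f (-R : ℂ) (R + c * I)
      (hd.mono fun z hz => ⟨trivial, by
        have := hz.2
        simpa [Set.uIcc_of_le hc] using this⟩)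
    simp only [neg_re, ofReal_re, neg_im, ofReal_im, neg_zero, add_re, mul_re, I_re, mul_zero,
      ofReal_zero, zero_mul, add_zero, I_im, mul_one, add_im, mul_im, zero_add,
      smul_eq_mul, sub_self, ofReal_neg] at this
    linear_combination this
  have hl := (intervalIntegral_tendsto_integral h0 tendsto_neg_atTop_atBot tendsto_id).sub
    (intervalIntegral_tendsto_integral h1 tendsto_neg_atTop_atBot tendsto_id)
  have hr : Tendsto (fun R : ℝ => (∫ x : ℝ in -R..R, f x) - (∫ x : ℝ in -R..R, f (x + c * I)))
      atTop (𝓝 0) := by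
    simp_rw [hrect]
    have h2 : Tendsto (fun R => b R * |c - 0| + b R * |c - 0|) atTop (𝓝 0) := by
      simpa using (hb.mul_const |c - 0|).add (hb.mul_const |c - 0|)
    refine squeeze_zero_norm' ?_ h2
    filter_upwards [hbd] with R hR
    refine (norm_sub_le _ _).trans (add_le_add ?_ ?_)
    · rw [norm_mul, norm_I, one_mul]
      refine intervalIntegral.norm_integral_le_of_norm_le_const fun y hy => (hR y ?_).2
      rw [Set.uIoc_of_le hc] at hy
      exact ⟨hy.1.le, hy.2⟩
    · rw [norm_mul, norm_I, one_mul]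
      refine intervalIntegral.norm_integral_le_of_norm_le_const fun y hy => (hR y ?_).1
      rw [Set.uIoc_of_le hc] at hy
      exact ⟨hy.1.le, hy.2⟩
  exact sub_eq_zero.1 (tendsto_nhds_unique hl hr)

/-- The Gaussian wave `e^(-3αz² + πi(2k+1)z)`. -/
noncomputable def gaussWave (α : ℝ) (k : ℤ) (z : ℂ) : ℂ :=
  exp (-(3 * α) * z ^ 2 + Real.pi * (2 * k + 1) * I * z)

/-- The integral of a Gaussian wave against `tanh`. -/
noncomputable def mordell (α : ℝ) (k : ℤ) : ℂ := ∫ x : ℝ, gaussWave α k x * tanh (α * x)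

lemma norm_gaussWave (α : ℝ) (k : ℤ) (x y : ℝ) : ‖gaussWave α k (x + y * I)‖ =
    Real.exp (-(3 * α) * x ^ 2) * Real.exp (3 * α * y ^ 2 - Real.pi * (2 * k + 1) * y) := by
  have e : (-(3 * α) * (x + y * I) ^ 2 + Real.pi * (2 * k + 1) * I * (x + y * I) : ℂ) =
      ((-(3 * α) * x ^ 2 + (3 * α * y ^ 2 - Real.pi * (2 * k + 1) * y) : ℝ) : ℂ) +
      ((-(6 * α) * x * y + Real.pi * (2 * k + 1) * x : ℝ) : ℂ) * I := by
    push_cast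
    linear_combination (-(3 * α) * y ^ 2 + Real.pi * (2 * k + 1) * y : ℂ) * I_sq
  rw [gaussWave, norm_exp, e, add_re, re_ofReal_mul, I_re, mul_zero, add_zero, ofReal_re, Real.exp_add]

lemma cosh_add_mul_I (x y : ℝ) : cosh (x + y * I) =
    (Real.cosh x * Real.cos y : ℝ) + (Real.sinh x * Real.sin y : ℝ) * I := by
  rw [Complex.cosh_add, cosh_mul_I, sinh_mul_I]; push_cast; ring

lemma sinh_add_mul_I (x y : ℝ) : sinh (x + y * I) =
    (Real.sinh x * Real.cos y : ℝ) + (Real.cosh x * Real.sin y : ℝ) * I := by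
  rw [Complex.sinh_add, cosh_mul_I, sinh_mul_I]; push_cast; ring

lemma norm_sinh_le (x y : ℝ) : ‖sinh (x + y * I)‖ ≤ Real.cosh x := by
  refine (sq_le_sq₀ (norm_nonneg _) (Real.cosh_pos x).le).1 ?_
  rw [sinh_add_mul_I, ← normSq_eq_norm_sq, normSq_add_mul_I, mul_pow, mul_pow, Real.cosh_sq]
  nlinarith [Real.sin_sq_add_cos_sq y, sq_nonneg (Real.cos y)]

lemma abs_sinh_le_norm_cosh (x y : ℝ) : |Real.sinh x| ≤ ‖cosh (x + y * I)‖ := by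
  refine (sq_le_sq₀ (abs_nonneg _) (norm_nonneg _)).1 ?_
  rw [cosh_add_mul_I, ← normSq_eq_norm_sq, normSq_add_mul_I, mul_pow, mul_pow, Real.cosh_sq, sq_abs]
  nlinarith [Real.sin_sq_add_cos_sq y, sq_nonneg (Real.cos y)]

lemma cosh_mul_cos_le_norm_cosh (x y : ℝ) : Real.cosh x * Real.cos y ≤ ‖cosh (x + y * I)‖ := by
  have := re_le_norm (cosh (x + y * I))
  rwa [cosh_add_mul_I, add_re, re_ofReal_mul, I_re, mul_zero, add_zero, ofReal_re,
    ← cosh_add_mul_I] at this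

lemma cosh_ne_zero {x y : ℝ} (h : x ≠ 0 ∨ Real.cos y ≠ 0) : cosh (x + y * I) ≠ 0 := by
  rw [cosh_add_mul_I]
  intro h0
  have h1 := congrArg re h0
  have h2 := congrArg im h0
  simp only [add_re, re_ofReal_mul, I_re, mul_zero, add_zero, ofReal_re, zero_re, mul_eq_zero,
    (Real.cosh_pos x).ne', false_or, add_im, im_ofReal_mul, I_im, mul_one, ofReal_im, zero_add,
    zero_im, Real.sinh_eq_zero] at h1 h2
  have := Real.sin_sq_add_cos_sq y
  rcases h2 with h2 | h2
  · tauto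
  · rw [h1, h2] at this; norm_num at this

lemma norm_tanh_le_two_of_cos {x y : ℝ} (h : 1 / 2 ≤ Real.cos y) : ‖tanh (x + y * I)‖ ≤ 2 := by
  have hc := Real.cosh_pos x
  have h1 := cosh_mul_cos_le_norm_cosh x y
  have h2 := norm_sinh_le x y
  rw [Complex.tanh_eq_sinh_div_cosh, norm_div, div_le_iff₀ (lt_of_lt_of_le (by positivity) h1)]
  nlinarith

lemma cosh_le_two_mul_sinh {x : ℝ} (hx : 1 ≤ x) : Real.cosh x ≤ 2 * Real.sinh x := by
  rw [Real.cosh_eq, Real.sinh_eq]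
  have h1 := Real.add_one_le_exp x
  have h2 : Real.exp x * Real.exp (-x) = 1 := by rw [← Real.exp_add]; simp
  have h3 := Real.exp_pos (-x)
  nlinarith [mul_le_mul h1 h1 (by linarith) (by linarith)]

lemma cosh_le_two_mul_abs_sinh {x : ℝ} (hx : 1 ≤ |x|) : Real.cosh x ≤ 2 * |Real.sinh x| := by
  rw [← Real.cosh_abs, Real.abs_sinh]
  exact cosh_le_two_mul_sinh hx

lemma norm_tanh_le_two_of_abs {x : ℝ} (y : ℝ) (hx : 1 ≤ |x|) : ‖tanh (x + y * I)‖ ≤ 2 := by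
  have h1 := abs_sinh_le_norm_cosh x y
  have h2 := norm_sinh_le x y
  have h3 := cosh_le_two_mul_abs_sinh hx
  have := Real.cosh_pos x
  rw [Complex.tanh_eq_sinh_div_cosh, norm_div, div_le_iff₀ (by linarith)]
  linarith

/-- Weak decay, but enough to make the vertical sides of the contour disappear. -/
lemma norm_inv_cosh_le {x : ℝ} (y : ℝ) (hx : 1 ≤ |x|) : ‖1 / cosh (x + y * I)‖ ≤ 1 / |x| := by
  rw [norm_div, norm_one]
  refine one_div_le_one_div_of_le (by linarith) (le_trans ?_ (abs_sinh_le_norm_cosh x y))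
  rw [Real.abs_sinh]
  exact Real.self_le_sinh_iff.2 (abs_nonneg x)

lemma integrable_inv_cosh : Integrable fun x : ℝ => 1 / Real.cosh x := by
  have hc : Continuous fun x : ℝ => 1 / Real.cosh x :=
    continuous_const.div Real.continuous_cosh fun x => (Real.cosh_pos x).ne'
  refine (integrable_inv_one_add_sq.const_mul 2).mono' hc.aestronglyMeasurable (ae_of_all _ fun x => ?_)
  -- The half-angle formula gives cosh x ≥ 1 + x²/2, hence comparison with 2/(1 + x²).
  have h1 : Real.cosh x = 1 + 2 * Real.sinh (x / 2) ^ 2 := by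
    have := Real.cosh_two_mul (x / 2)
    rw [mul_div_cancel₀ x two_ne_zero, Real.cosh_sq] at this
    linarith
  have h2 : (x / 2) ^ 2 ≤ Real.sinh (x / 2) ^ 2 := by
    rw [← sq_abs (x / 2), ← sq_abs (Real.sinh _), Real.abs_sinh]
    have := Real.self_le_sinh_iff.2 (abs_nonneg (x / 2))
    gcongr
  have hp := Real.cosh_pos x
  rw [Real.norm_of_nonneg (by positivity), ← div_eq_mul_inv, div_le_div_iff₀ hp (by positivity)]
  nlinarith

lemma integral_inv_cosh : ∫ x : ℝ, 1 / Real.cosh x = Real.pi := by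
  have := integral_of_hasDerivAt_of_tendsto (f := fun x => Real.arctan (Real.sinh x))
    (f' := fun x => 1 / Real.cosh x) (m := -(Real.pi / 2)) (n := Real.pi / 2)
    (fun x => by
      have h := (Real.hasDerivAt_sinh x).arctan
      rwa [add_comm, ← Real.cosh_sq, show 1 / Real.cosh x ^ 2 * Real.cosh x = 1 / Real.cosh x by
        have := (Real.cosh_pos x).ne'; field_simp] at h)
    integrable_inv_cosh
    ((tendsto_nhds_of_tendsto_nhdsWithin Real.tendsto_arctan_atBot).comp
      Real.sinhOrderIso.tendsto_atBot)
    ((tendsto_nhds_of_tendsto_nhdsWithin Real.tendsto_arctan_atTop).comp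
      Real.sinhOrderIso.tendsto_atTop)
  rw [this]; ring

lemma integrable_inv_cosh_mul {α : ℝ} (hα : 0 < α) :
    Integrable fun x : ℝ => 1 / cosh ((α : ℂ) * x) := by
  have := ((integrable_inv_cosh.comp_mul_left' hα.ne')).ofReal (𝕜 := ℂ)
  refine this.congr (ae_of_all _ fun x => ?_)
  simp

lemma integral_inv_cosh_mul {α : ℝ} (hα : 0 < α) :
    ∫ x : ℝ, 1 / cosh ((α : ℂ) * x) = Real.pi / α := by
  have h1 : ∀ x : ℝ, 1 / cosh ((α : ℂ) * x) = ((1 / Real.cosh (α * x) : ℝ) : ℂ) := by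
    intro x; simp
  simp_rw [h1]
  rw [integral_complex_ofReal, Measure.integral_comp_mul_left (fun x => 1 / Real.cosh x), integral_inv_cosh,
    abs_of_pos (inv_pos.2 hα)]
  simp [div_eq_inv_mul]

lemma differentiable_gaussWave (α : ℝ) (k : ℤ) : Differentiable ℂ (gaussWave α k) := by
  unfold gaussWave; fun_prop

lemma integrable_gaussWave_mul {α : ℝ} (hα : 0 < α) (k : ℤ) (y : ℝ) {g : ℝ → ℂ}
    (hg : Continuous g) {C : ℝ} (hC : ∀ x, ‖g x‖ ≤ C) :
    Integrable fun x : ℝ => gaussWave α k (x + y * I) * g x := by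
  refine Integrable.mul_bdd (c := C) ?_ hg.aestronglyMeasurable (ae_of_all _ hC)
  have h := integrable_cexp_quadratic (b := 3 * α) (by simpa using hα)
    (-(6 * α) * y * I + Real.pi * (2 * k + 1) * I)
    (-(3 * α) * (y * I) ^ 2 + Real.pi * (2 * k + 1) * I * (y * I))
  refine h.congr (ae_of_all _ fun x => ?_)
  simp only [gaussWave]
  congr 1
  ring

lemma continuous_tanh_add {α y : ℝ} (h : Real.cos y ≠ 0) :
    Continuous fun x : ℝ => tanh ((α : ℂ) * x + y * I) := by
  have e : (fun x : ℝ => tanh ((α : ℂ) * x + y * I)) =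
      fun x : ℝ => sinh ((α : ℂ) * x + y * I) / cosh ((α : ℂ) * x + y * I) := by
    ext x; exact Complex.tanh_eq_sinh_div_cosh _
  rw [e]
  refine Continuous.div (by fun_prop) (by fun_prop) fun x => ?_
  have := cosh_ne_zero (x := α * x) (y := y) (Or.inr h)
  push_cast at this
  exact this

lemma norm_gaussWave_le {α : ℝ} (hα : 0 < α) (k : ℤ) {c : ℝ} (x : ℝ) {y : ℝ}
    (hy : y ∈ Set.Icc 0 c) : ‖gaussWave α k (x + y * I)‖ ≤
      Real.exp (-(3 * α) * x ^ 2) * Real.exp (3 * α * c ^ 2 + Real.pi * |2 * (k : ℝ) + 1| * c) := by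
  rw [norm_gaussWave]
  have h1 : y ^ 2 ≤ c ^ 2 := by have := hy.1; have := hy.2; gcongr
  have h2 : -(Real.pi * (2 * k + 1) * y) ≤ Real.pi * |2 * (k : ℝ) + 1| * c := by
    calc -(Real.pi * (2 * k + 1) * y) = Real.pi * (-(2 * k + 1)) * y := by ring
      _ ≤ Real.pi * |2 * (k : ℝ) + 1| * y := by
        have := hy.1; have := Real.pi_pos; gcongr; exact neg_le_abs _
      _ ≤ _ := by have := hy.2; have := Real.pi_pos; gcongr
  gcongr
  nlinarith

lemma tendsto_exp_neg_sq {α : ℝ} (hα : 0 < α) :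
    Tendsto (fun x : ℝ => Real.exp (-(3 * α) * x ^ 2)) atTop (𝓝 0) := by
  refine Real.tendsto_exp_atBot.comp ?_
  have := (tendsto_pow_atTop (α := ℝ) two_ne_zero).const_mul_atTop (by positivity : 0 < 3 * α)
  refine (tendsto_neg_atTop_atBot.comp this).congr fun x => ?_
  simp

/-! ### Evaluating and relating the integrals -/

/-- The integral of lowest frequency, moved to its saddle point. -/
lemma mordell_zero_eq_shift {α : ℝ} (hα : 0 < α) : mordell α 0 =
    ∫ x : ℝ, gaussWave α 0 (x + (Real.pi / (6 * α) : ℝ) * I) *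
      tanh (α * x + (Real.pi / 6 : ℝ) * I) := by
  have hπ := Real.pi_pos
  set c := Real.pi / (6 * α) with hc
  have hc0 : 0 < c := by positivity
  have hαc : α * c = Real.pi / 6 := by rw [hc]; field_simp
  -- The saddle point iπ/(6α) lies below the first pole iπ/(2α) of tanh(αz), so no residue appears.
  have hcos (y : ℝ) (hy : y ∈ Set.Icc 0 c) : 1 / 2 ≤ Real.cos (α * y) := by
    rw [← Real.cos_pi_div_three]
    have h1 : α * y ≤ Real.pi / 6 := by rw [← hαc]; have := hy.2; gcongr
    exact Real.cos_le_cos_of_nonneg_of_le_pi (mul_nonneg hα.le hy.1) (by linarith) (by linarith)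
  have harg (x y : ℝ) : (α : ℂ) * (x + y * I) = ((α * x : ℝ) : ℂ) + ((α * y : ℝ) : ℂ) * I := by
    push_cast; ring
  have h0 : Integrable fun x : ℝ => gaussWave α 0 x * tanh (α * x) := by
    simpa using integrable_gaussWave_mul hα 0 0 (continuous_tanh_add (α := α) (y := 0) (by simp))
      (C := 2) fun x => by
        have := norm_tanh_le_two_of_cos (x := α * x) (y := 0) (by norm_num)
        simpa using this
  have hcc : 1 / 2 ≤ Real.cos (Real.pi / 6) := by
    rw [← hαc]; exact hcos c ⟨hc0.le, le_rfl⟩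
  have h1 : Integrable fun x : ℝ => gaussWave α 0 (x + c * I) *
      tanh (α * x + (Real.pi / 6 : ℝ) * I) :=
    integrable_gaussWave_mul hα 0 c (continuous_tanh_add (by linarith)) (C := 2) fun x => by
      have := norm_tanh_le_two_of_cos (x := α * x) hcc
      rwa [ofReal_mul] at this
  have hshift (x : ℝ) : (α : ℂ) * (x + c * I) = α * x + (Real.pi / 6 : ℝ) * I := by
    rw [harg, hαc, ofReal_mul]
  have key := integral_eq_integral_add_mul_I (f := fun z => gaussWave α 0 z * tanh (α * z)) hc0.le
    (fun z hz => ?_) h0 (by simpa only [hshift] using h1)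
    (b := fun x => Real.exp (-(3 * α) * x ^ 2) *
      Real.exp (3 * α * c ^ 2 + Real.pi * |2 * ((0 : ℤ) : ℝ) + 1| * c) * 2) ?_ ?_
  · simpa only [hshift, mordell] using key
  · have hne : cosh ((α : ℂ) * z) ≠ 0 := by
      rw [← re_add_im z, harg]
      exact cosh_ne_zero (Or.inr (by have := hcos z.im hz.2; linarith))
    have hd : DifferentiableAt ℂ (fun z : ℂ => tanh (α * z)) z := by
      simp only [Complex.tanh_eq_sinh_div_cosh]
      exact DifferentiableAt.div (by fun_prop) (by fun_prop) hne
    exact ((differentiable_gaussWave α 0 z).mul hd).differentiableWithinAt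
  · simpa using ((tendsto_exp_neg_sq hα).mul_const _).mul_const 2
  · refine Eventually.of_forall fun x y hy => ⟨?_, ?_⟩
    · rw [norm_mul, harg]
      gcongr
      · exact norm_gaussWave_le hα 0 x hy
      · exact norm_tanh_le_two_of_cos (hcos y hy)
    · rw [← ofReal_neg, norm_mul, harg, ← neg_sq x]
      gcongr
      · exact norm_gaussWave_le hα 0 (-x) hy
      · exact norm_tanh_le_two_of_cos (hcos y hy)

lemma integrable_mordell {α : ℝ} (hα : 0 < α) (k : ℤ) :
    Integrable fun x : ℝ => gaussWave α k x * tanh (α * x) := by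
  simpa using integrable_gaussWave_mul hα k 0 (continuous_tanh_add (α := α) (y := 0) (by simp))
    (C := 2) fun x => by
      have := norm_tanh_le_two_of_cos (x := α * x) (y := 0) (by norm_num)
      simpa using this

lemma mordell_neg (α : ℝ) (k : ℤ) : mordell α (-1 - k) = -mordell α k := by
  rw [mordell, mordell, ← integral_neg_eq_self, ← integral_neg]
  congr 1
  ext x
  have : gaussWave α (-1 - k) (-x : ℝ) = gaussWave α k x := by
    simp only [gaussWave]; congr 1; push_cast; ring
  rw [this]
  push_cast
  rw [mul_neg, Complex.tanh_neg, mul_neg]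

lemma gaussWave_add_period {α : ℝ} (hα : 0 < α) (k : ℤ) (z : ℂ) :
    gaussWave α k (z + (Real.pi / α : ℝ) * I) =
      exp ((Real.pi ^ 2 / α : ℝ) * (2 - 2 * k)) * gaussWave α (k - 3) z := by
  have hα0 : (α : ℂ) ≠ 0 := by exact_mod_cast hα.ne'
  simp only [gaussWave]
  rw [← Complex.exp_add]
  congr 1
  push_cast
  field_simp
  linear_combination ((-3 : ℂ) * Real.pi ^ 2 + Real.pi ^ 2 * (2 * k + 1)) * I_sq

lemma gaussWave_pole {α : ℝ} (hα : 0 < α) (k : ℤ) :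
    gaussWave α k ((Real.pi / (2 * α) : ℝ) * I) =
      exp ((Real.pi ^ 2 / α : ℝ) * (1 / 4 - k)) := by
  have hα0 : (α : ℂ) ≠ 0 := by exact_mod_cast hα.ne'
  simp only [gaussWave]
  congr 1
  push_cast
  field_simp
  linear_combination 4 * ((-3 : ℂ) + 2 * (2 * k + 1)) * I_sq

/-- Moving the contour across the pole of `tanh` lowers the frequency by three. -/
lemma mordell_eq_mordell_sub_three {α : ℝ} (hα : 0 < α) (k : ℤ) : mordell α k =
    exp ((Real.pi ^ 2 / α : ℝ) * (2 - 2 * k)) * mordell α (k - 3) +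
      2 * Real.pi * I / α * exp ((Real.pi ^ 2 / α : ℝ) * (1 / 4 - k)) := by
  have hπ := Real.pi_pos
  have hα0 : (α : ℂ) ≠ 0 := by exact_mod_cast hα.ne'
  set c := Real.pi / α with hc
  have hc0 : 0 < c := by positivity
  have hαc : α * c = Real.pi := by rw [hc]; field_simp
  set z₀ : ℂ := (Real.pi / (2 * α) : ℝ) * I with hz₀
  have hαz₀ : (α : ℂ) * z₀ = (Real.pi / 2 : ℝ) * I := by
    rw [hz₀]; push_cast; field_simp
  set G := gaussWave α k z₀ with hG
  set N : ℂ → ℂ := fun z => gaussWave α k z * sinh (α * z) - I * G with hN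
  set D : ℂ → ℂ := fun z => cosh (α * z) with hD
  have hNd : Differentiable ℂ N := by
    have := differentiable_gaussWave α k
    fun_prop
  have hDd : Differentiable ℂ D := by fun_prop
  have hs : sinh ((α : ℂ) * z₀) = I := by
    rw [hαz₀, sinh_mul_I, ← ofReal_sin, Real.sin_pi_div_two]; simp
  have hN0 : N z₀ = 0 := by simp only [hN, hs, ← hG]; ring
  have hD0 : D z₀ = 0 := by
    simp only [hD, hαz₀, cosh_mul_I, ← ofReal_cos, Real.cos_pi_div_two, ofReal_zero]
  have hD' : deriv D z₀ = α * I := by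
    have : HasDerivAt D (sinh (α * z₀) * (α * 1)) z₀ :=
      ((hasDerivAt_id z₀).const_mul (α : ℂ)).ccosh
    rw [this.deriv, hs]; ring
  set f : ℂ → ℂ := fun z => dslope N z₀ z / dslope D z₀ z with hf
  have hfN (z : ℂ) (hz : z ≠ z₀) : f z = N z / D z := by
    have hsub := sub_ne_zero.2 hz
    simp only [hf, dslope_of_ne _ hz, slope_def_field, hN0, hD0, sub_zero]
    field_simp
  have hDne (x y : ℝ) (hy : y ∈ Set.Icc 0 c) (hne : (x + y * I : ℂ) ≠ z₀) :
      D (x + y * I) ≠ 0 := by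
    have e : (α : ℂ) * (x + y * I) = ((α * x : ℝ) : ℂ) + ((α * y : ℝ) : ℂ) * I := by
      push_cast; ring
    simp only [hD, e]
    refine cosh_ne_zero ?_
    by_contra! h
    obtain ⟨h1, h2⟩ := h
    have hx : x = 0 := by simpa [hα.ne'] using h1
    refine hne ?_
    have hαy : α * y ≤ Real.pi := by rw [← hαc]; have := hy.2; gcongr
    have hαy0 : 0 ≤ α * y := mul_nonneg hα.le hy.1
    have : α * y = Real.pi / 2 := by
      refine Real.injOn_cos ⟨hαy0, hαy⟩ ⟨by linarith, by linarith⟩ ?_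
      rw [h2, Real.cos_pi_div_two]
    have hy' : y = Real.pi / (2 * α) := by field_simp; linarith
    rw [hx, hz₀, hy']; simp
  have hfd : DifferentiableOn ℂ f (Set.univ ×ℂ Set.Icc 0 c) := by
    intro z hz
    have h1 : DifferentiableAt ℂ (dslope N z₀) z :=
      (((differentiableOn_dslope univ_mem).2 hNd.differentiableOn).differentiableAt univ_mem)
    have h2 : DifferentiableAt ℂ (dslope D z₀) z :=
      (((differentiableOn_dslope univ_mem).2 hDd.differentiableOn).differentiableAt univ_mem)
    refine (h1.div h2 ?_).differentiableWithinAt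
    by_cases hzz : z = z₀
    · rw [hzz, dslope_same, hD']; exact mul_ne_zero hα0 I_ne_zero
    · rw [dslope_of_ne _ hzz, slope_def_field, hD0, sub_zero]
      refine div_ne_zero ?_ (sub_ne_zero.2 hzz)
      have := hDne z.re z.im hz.2
      rw [re_add_im] at this
      exact this hzz
  have hne_of_re (x y : ℝ) (hx : x ≠ 0) : (x + y * I : ℂ) ≠ z₀ := by
    intro h
    have := congrArg re h
    rw [hz₀, re_ofReal_mul, I_re, mul_zero] at this
    exact hx (by simpa using this)
  have hfx (z : ℂ) (hz : z ≠ z₀) :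
      f z = gaussWave α k z * tanh (α * z) - I * G * (1 / cosh (α * z)) := by
    rw [hfN z hz, hN, hD, Complex.tanh_eq_sinh_div_cosh]; ring
  have hz₀im : z₀.im = Real.pi / (2 * α) := by
    rw [hz₀, im_ofReal_mul, I_im, mul_one]
  have hf0 (x : ℝ) : f x = gaussWave α k x * tanh (α * x) - I * G * (1 / cosh (α * x)) := by
    refine hfx x fun h => ?_
    have := congrArg im h
    rw [hz₀im, ofReal_im] at this
    have h3 : 0 < Real.pi / (2 * α) := by positivity
    linarith
  have hf1 (x : ℝ) : f (x + c * I) = exp ((Real.pi ^ 2 / α : ℝ) * (2 - 2 * k)) *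
      (gaussWave α (k - 3) x * tanh (α * x)) + I * G * (1 / cosh (α * x)) := by
    have e : (α : ℂ) * (x + c * I) = α * x + Real.pi * I := by
      rw [← hαc]; push_cast; ring
    rw [hfx, hc, gaussWave_add_period hα, ← hc, e, Complex.tanh_eq_sinh_div_cosh,
      Complex.tanh_eq_sinh_div_cosh, Complex.sinh_add, Complex.cosh_add, cosh_mul_I, sinh_mul_I,
      Complex.cos_pi, Complex.sin_pi]
    · simp only [mul_neg, mul_one, zero_mul, mul_zero, add_zero, neg_div_neg_eq]
      rw [one_div_neg_eq_neg_one_div]; ring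
    · intro h
      have := congrArg im h
      rw [hz₀im] at this
      simp only [add_im, ofReal_im, mul_im, ofReal_re, I_im, mul_one, I_re, mul_zero, add_zero,
        zero_add, hc] at this
      rw [div_eq_div_iff hα.ne' (by positivity)] at this
      nlinarith [mul_pos hπ hα]
  have i0 := integrable_mordell hα k
  have i1 := integrable_mordell hα (k - 3)
  have is := integrable_inv_cosh_mul hα
  have key := integral_eq_integral_add_mul_I (f := f) hc0.le hfd
    ((i0.sub (is.const_mul (I * G))).congr (ae_of_all _ fun x => (hf0 x).symm))
    (((i1.const_mul _).add (is.const_mul (I * G))).congr (ae_of_all _ fun x => (hf1 x).symm))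
    (b := fun x => Real.exp (-(3 * α) * x ^ 2) *
      Real.exp (3 * α * c ^ 2 + Real.pi * |2 * (k : ℝ) + 1| * c) * 2 + ‖I * G‖ * (1 / (α * x)))
    ?_ ?_
  · simp_rw [hf0, hf1] at key
    rw [integral_sub i0 (is.const_mul _), integral_add (i1.const_mul _) (is.const_mul _),
      integral_const_mul, integral_const_mul, integral_inv_cosh_mul hα, ← mordell, ← mordell,
      hG, hz₀, gaussWave_pole hα] at key
    linear_combination key
  · have h1 : Tendsto (fun x : ℝ => 1 / (α * x)) atTop (𝓝 0) := by
      exact (tendsto_inv_atTop_zero.comp (tendsto_id.const_mul_atTop hα)).congr fun x => by simp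
    simpa using (((tendsto_exp_neg_sq hα).mul_const _).mul_const 2).add (h1.const_mul ‖I * G‖)
  · have hbound (x y : ℝ) (hy : y ∈ Set.Icc 0 c) (hx : 1 ≤ α * |x|) : ‖f (x + y * I)‖ ≤
        Real.exp (-(3 * α) * x ^ 2) *
          Real.exp (3 * α * c ^ 2 + Real.pi * |2 * (k : ℝ) + 1| * c) * 2 +
          ‖I * G‖ * (1 / (α * |x|)) := by
      have hx0 : x ≠ 0 := by rintro rfl; norm_num at hx
      have e : (α : ℂ) * (x + y * I) = ((α * x : ℝ) : ℂ) + ((α * y : ℝ) : ℂ) * I := by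
        push_cast; ring
      have ha : |α * x| = α * |x| := by rw [abs_mul, abs_of_pos hα]
      rw [hfx _ (hne_of_re x y hx0)]
      refine (norm_sub_le _ _).trans (add_le_add ?_ ?_)
      · rw [norm_mul, e]
        gcongr
        · exact norm_gaussWave_le hα k x hy
        · exact norm_tanh_le_two_of_abs _ (by rwa [ha])
      · rw [norm_mul, e, ← ha]
        gcongr
        exact norm_inv_cosh_le _ (by rwa [ha])
    filter_upwards [eventually_ge_atTop (1 / α)] with x hx y hy
    have hx0 : 0 < x := lt_of_lt_of_le (by positivity) hx
    have hx1 : 1 ≤ α * |x| := by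
      rw [abs_of_pos hx0]; rw [div_le_iff₀ hα] at hx; linarith
    refine ⟨by simpa [abs_of_pos hx0] using hbound x y hy hx1, ?_⟩
    have := hbound (-x) y hy (by rwa [abs_neg])
    rwa [abs_neg, abs_of_pos hx0, neg_sq, ofReal_neg] at this

/-- tanh a + tanh b = sinh(a + b)/(cosh a cosh b) with a + b = iπ/3. Writing s = sinh(αx), the
denominator is (4s² + 3)/4, and sinh(3αx) = s(4s² + 3). -/
lemma tanh_add_tanh_neg {α x : ℝ} (hα : 0 < α) (hx : 0 < x) :
    tanh (α * x + (Real.pi / 6 : ℝ) * I) + tanh (α * -x + (Real.pi / 6 : ℝ) * I) =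
      2 * (Real.sqrt 3 : ℂ) * I * (sinh (α * x) / sinh (3 * α * x)) := by
  have hs3 : (Real.sqrt 3 : ℂ) ^ 2 = 3 := by
    rw [← ofReal_pow, Real.sq_sqrt (by norm_num)]; norm_num
  have hcos : 1 / 2 ≤ Real.cos (Real.pi / 6) := by
    rw [Real.cos_pi_div_six]
    have : 1 ≤ Real.sqrt 3 := by rw [Real.one_le_sqrt]; norm_num
    linarith
  have h1 := cosh_ne_zero (x := α * x) (y := Real.pi / 6) (Or.inr (by linarith))
  have h2 := cosh_ne_zero (x := α * -x) (y := Real.pi / 6) (Or.inr (by linarith))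
  have h3 : sinh (3 * ((α : ℂ) * x)) ≠ 0 := by
    have : Real.sinh (3 * (α * x)) ≠ 0 := by
      rw [Ne, Real.sinh_eq_zero]; positivity
    have h := ofReal_ne_zero.2 this
    push_cast at h
    exact h
  push_cast at h1 h2
  rw [mul_assoc 3 (α : ℂ)]
  push_cast
  rw [Complex.tanh_eq_sinh_div_cosh, Complex.tanh_eq_sinh_div_cosh, div_add_div _ _ h1 h2,
    mul_div_assoc', div_eq_div_iff (mul_ne_zero h1 h2) h3]
  have hc6 : cos ((Real.pi : ℂ) / 6) = (Real.sqrt 3 : ℂ) / 2 := by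
    have := congrArg ofReal Real.cos_pi_div_six
    push_cast at this
    exact this
  have hs6 : sin ((Real.pi : ℂ) / 6) = 1 / 2 := by
    have := congrArg ofReal Real.sin_pi_div_six
    push_cast at this
    exact this
  simp only [Complex.sinh_add, Complex.cosh_add, cosh_mul_I, sinh_mul_I, hc6, hs6, mul_neg,
    Complex.sinh_neg, Complex.cosh_neg, Complex.sinh_three_mul]
  generalize hs : sinh ((α : ℂ) * x) = s
  generalize hc : cosh ((α : ℂ) * x) = t
  have hcs : t ^ 2 = s ^ 2 + 1 := by rw [← hs, ← hc, Complex.cosh_sq]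
  generalize (Real.sqrt 3 : ℂ) = u at hs3 ⊢
  have hnum : (s * (u / 2) + t * (1 / 2 * I)) * (t * (u / 2) - s * (1 / 2 * I)) +
      (t * (u / 2) + s * (1 / 2 * I)) * (-(s * (u / 2)) + t * (1 / 2 * I)) = u * I / 2 := by
    linear_combination (u * I / 2) * hcs
  have hden : (t * (u / 2) + s * (1 / 2 * I)) * (t * (u / 2) - s * (1 / 2 * I)) =
      (4 * s ^ 2 + 3) / 4 := by
    linear_combination (t ^ 2 / 4) * hs3 - (s ^ 2 / 4) * I_sq + (3 / 4) * hcs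
  linear_combination (4 * s ^ 3 + 3 * s) * hnum - 2 * u * I * s * hden

lemma gaussWave_zero_shift {α : ℝ} (hα : 0 < α) (x : ℝ) :
    gaussWave α 0 (x + (Real.pi / (6 * α) : ℝ) * I) =
      exp (-((Real.pi ^ 2 / α : ℝ) / 12)) * exp (-3 * α * (x : ℂ) ^ 2) := by
  have hα0 : (α : ℂ) ≠ 0 := by exact_mod_cast hα.ne'
  rw [gaussWave, ← Complex.exp_add]
  congr 1
  push_cast
  field_simp
  linear_combination (36 * Real.pi ^ 2 : ℂ) * I_sq

/-- The integral of lowest frequency is a multiple of `W₃`. -/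
lemma mordell_zero {α : ℝ} (hα : 0 < α) : mordell α 0 =
    exp (-((Real.pi ^ 2 / α : ℝ) / 12)) * (2 * (Real.sqrt 3 : ℂ) * I * W₃ α) := by
  have hcos : 1 / 2 ≤ Real.cos (Real.pi / 6) := by
    rw [Real.cos_pi_div_six]
    have : 1 ≤ Real.sqrt 3 := by rw [Real.one_le_sqrt]; norm_num
    linarith
  rw [mordell_zero_eq_shift hα]
  simp_rw [gaussWave_zero_shift hα, mul_assoc (exp (-((Real.pi ^ 2 / α : ℝ) / 12)))]
  rw [integral_const_mul]
  congr 1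
  set F : ℝ → ℂ := fun x => exp (-3 * α * (x : ℂ) ^ 2) * tanh (α * x + (Real.pi / 6 : ℝ) * I) with hF
  have hFi : Integrable F := by
    have := integrable_gaussWave_mul hα 0 (Real.pi / (6 * α))
      (continuous_tanh_add (α := α) (y := Real.pi / 6) (by linarith)) (C := 2) fun x => by
      have := norm_tanh_le_two_of_cos (x := α * x) hcos
      rwa [ofReal_mul] at this
    simp_rw [gaussWave_zero_shift hα] at this
    refine (this.const_mul (exp ((Real.pi ^ 2 / α : ℝ) / 12))).congr (ae_of_all _ fun x => ?_)
    simp only [hF]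
    rw [← mul_assoc, ← mul_assoc, ← Complex.exp_add, add_neg_cancel, Complex.exp_zero, one_mul]
  have hFn : IntegrableOn (fun x => F (-x)) (Set.Ioi 0) := hFi.comp_neg.integrableOn
  -- Folding the line onto the half line turns the shifted tanh into the kernel of `W₃`.
  rw [← intervalIntegral.integral_Iic_add_Ioi (b := 0) hFi.integrableOn hFi.integrableOn]
  have h0 := integral_comp_neg_Ioi 0 F
  rw [neg_zero] at h0
  rw [← h0, ← integral_add hFn hFi.integrableOn, W₃, ← integral_const_mul]
  refine setIntegral_congr_fun measurableSet_Ioi fun x hx => ?_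
  have := tanh_add_tanh_neg hα hx
  simp only [hF]
  push_cast at this ⊢
  rw [neg_sq]
  linear_combination exp (-3 * α * (x : ℂ) ^ 2) * this

/-! ### The pentagonal number theorem -/

lemma norm_prod_one_sub_pow_le {x : ℂ} (hx : ‖x‖ < 1) (k n : ℕ) :
    ‖∏ i ∈ Finset.range n, (1 - x ^ (k + i + 1))‖ ≤ Real.exp (1 - ‖x‖)⁻¹ := by
  have h0 := norm_nonneg x
  calc ‖∏ i ∈ Finset.range n, (1 - x ^ (k + i + 1))‖
      ≤ ∏ i ∈ Finset.range n, ‖1 - x ^ (k + i + 1)‖ := (norm_prod _ _).le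
    _ ≤ ∏ i ∈ Finset.range n, Real.exp (‖x‖ ^ i) := by
      refine Finset.prod_le_prod (fun _ _ => norm_nonneg _) fun i _ => ?_
      calc ‖1 - x ^ (k + i + 1)‖ ≤ ‖(1 : ℂ)‖ + ‖x ^ (k + i + 1)‖ := norm_sub_le _ _
        _ ≤ 1 + ‖x‖ ^ i := by
          rw [norm_one, norm_pow]
          exact add_le_add le_rfl (pow_le_pow_of_le_one h0 hx.le (by omega))
        _ ≤ _ := by rw [add_comm]; exact Real.add_one_le_exp _
    _ = Real.exp (∑ i ∈ Finset.range n, ‖x‖ ^ i) := (Real.exp_sum _ _).symm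
    _ ≤ _ := by
      rw [Real.exp_le_exp, ← tsum_geometric_of_lt_one h0 hx]
      exact (summable_geometric_of_lt_one h0 hx).sum_le_tsum _ fun i _ => by positivity

lemma le_pentagonal_neg (k : ℕ) : k ≤ pentagonal (-(k : ℤ)) := by
  have := two_mul_natCast_pentagonal_neg (k : ℤ)
  zify; nlinarith

lemma le_pentagonal_succ (k : ℕ) : k ≤ pentagonal ((k : ℤ) + 1) := by
  have := two_mul_natCast_pentagonal ((k : ℤ) + 1)
  zify; nlinarith

lemma summable_pentagonal {x : ℂ} (hx : ‖x‖ < 1) : Summable fun k : ℕ =>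
    (-1) ^ k * (x ^ pentagonal (-(k : ℤ)) - x ^ pentagonal ((k : ℤ) + 1)) := by
  have h0 := norm_nonneg x
  refine ((summable_geometric_of_lt_one h0 hx).mul_left 2).of_norm_bounded fun k => ?_
  rw [norm_mul, norm_pow, norm_neg, norm_one, one_pow, one_mul, two_mul]
  refine (norm_sub_le _ _).trans (add_le_add ?_ ?_) <;> rw [norm_pow]
  · exact pow_le_pow_of_le_one h0 hx.le (le_pentagonal_neg k)
  · exact pow_le_pow_of_le_one h0 hx.le (le_pentagonal_succ k)

lemma euler_eq_tsum {x : ℂ} (hx : ‖x‖ < 1) : euler x =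
    ∑' k : ℕ, (-1) ^ k * (x ^ pentagonal (-(k : ℤ)) - x ^ pentagonal ((k : ℤ) + 1)) := by
  have h0 := norm_nonneg x
  have hgeo := summable_geometric_of_lt_one h0 hx
  have hterm (k n : ℕ) : ‖x ^ ((k + 1) * n) * ∏ i ∈ Finset.range (n + 1), (1 - x ^ (k + i + 1))‖ ≤
      ‖x‖ ^ n * Real.exp (1 - ‖x‖)⁻¹ := by
    rw [norm_mul, norm_pow]
    gcongr ?_ * ?_
    · exact pow_le_pow_of_le_one h0 hx.le (by nlinarith)
    · exact norm_prod_one_sub_pow_le hx k (n + 1)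
  refine Pentagonal.tprod_one_sub_pow (tendsto_pow_atTop_nhds_zero_of_norm_lt_one hx)
    (fun k => (hgeo.mul_right _).of_norm_bounded (hterm k)) (fun k => ?_) (summable_pentagonal hx) ?_
  · have : Summable fun n : ℕ => ‖-x ^ (n + k + 1)‖ := by
      simpa [add_assoc] using (summable_nat_add_iff (k + 1)).2 hgeo
    simpa [sub_eq_add_neg] using multipliable_one_add_of_summable this
  · refine squeeze_zero_norm (a := fun k => ‖x‖ ^ k * ∑' n, ‖x‖ ^ n * Real.exp (1 - ‖x‖)⁻¹)
      (fun k => ?_) ?_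
    · rw [norm_mul, norm_mul, norm_pow, norm_neg, norm_one, one_pow, one_mul, norm_pow]
      gcongr ?_ * ?_
      · refine pow_le_pow_of_le_one h0 hx.le ?_
        rw [Nat.le_div_iff_mul_le two_pos]; nlinarith
      · exact tsum_of_norm_bounded (hgeo.mul_right _).hasSum (hterm k)
    · simpa using (tendsto_pow_atTop_nhds_zero_of_lt_one h0 hx).mul_const
        (∑' n, ‖x‖ ^ n * Real.exp (1 - ‖x‖)⁻¹)

lemma norm_exp_neg_lt_one {b : ℝ} (hb : 0 < b) : ‖exp (-(2 * (b : ℂ)))‖ < 1 := by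
  rw [norm_exp, Real.exp_lt_one_iff]; simpa using hb

/-- Completing the square: 24 g + 1 = (6k + 1)² for the pentagonal number g of index -k. -/
lemma exp_mul_pow_pentagonal_neg (b : ℝ) (k : ℕ) :
    exp (-b / 12) * exp (-(2 * (b : ℂ))) ^ pentagonal (-(k : ℤ)) =
      exp (-(b / 3) * ((3 * k : ℕ) + 1 / 2) ^ 2) := by
  rw [← Complex.exp_nat_mul, ← Complex.exp_add]
  congr 1
  have h := congrArg (Int.cast : ℤ → ℂ) (two_mul_natCast_pentagonal_neg (k : ℤ))
  push_cast at h ⊢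
  linear_combination (-(b : ℂ)) * h

lemma exp_mul_pow_pentagonal_succ (b : ℝ) (k : ℕ) :
    exp (-b / 12) * exp (-(2 * (b : ℂ))) ^ pentagonal ((k : ℤ) + 1) =
      exp (-(b / 3) * ((2 + 3 * k : ℕ) + 1 / 2) ^ 2) := by
  rw [← Complex.exp_nat_mul, ← Complex.exp_add]
  congr 1
  have h := congrArg (Int.cast : ℤ → ℂ) (two_mul_natCast_pentagonal ((k : ℤ) + 1))
  push_cast at h ⊢
  linear_combination (-(b : ℂ)) * h

/-- The character modulo three in the theta series of `η`. -/
def signModThree (k : ℕ) : ℂ := if k % 3 = 0 then 1 else if k % 3 = 1 then 0 else -1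

lemma norm_signModThree_le (k : ℕ) : ‖signModThree k‖ ≤ 1 := by
  unfold signModThree; split_ifs <;> simp

lemma norm_exp_theta_le {b : ℝ} (hb : 0 < b) (k : ℕ) :
    ‖exp (-((b : ℂ) / 3) * ((k : ℂ) + 1 / 2) ^ 2)‖ ≤ Real.exp (-(b / 3)) ^ k := by
  rw [show (-((b : ℂ) / 3) * ((k : ℂ) + 1 / 2) ^ 2) = ((-(b / 3) * ((k : ℝ) + 1 / 2) ^ 2 : ℝ) : ℂ) by
    push_cast; ring, ← ofReal_exp, norm_real, Real.norm_of_nonneg (Real.exp_nonneg _),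
    ← Real.exp_nat_mul, Real.exp_le_exp]
  have : (k : ℝ) ≤ ((k : ℝ) + 1 / 2) ^ 2 := by nlinarith [sq_nonneg ((k : ℝ) - 1 / 2)]
  nlinarith

lemma hasSum_etaExp {b : ℝ} (hb : 0 < b) :
    HasSum (fun k : ℕ => (-1) ^ k * exp (-((b : ℂ) / 3) * ((k : ℂ) + 1 / 2) ^ 2) * signModThree k)
      (etaExp b) := by
  set f : ℕ → ℂ := fun k => (-1) ^ k * exp (-((b : ℂ) / 3) * ((k : ℂ) + 1 / 2) ^ 2) * signModThree k
    with hf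
  have hlt : Real.exp (-(b / 3)) < 1 := by rw [Real.exp_lt_one_iff]; linarith
  have hs : Summable f := by
    refine (summable_geometric_of_lt_one (Real.exp_nonneg _) hlt).of_norm_bounded fun k => ?_
    rw [hf, norm_mul, norm_mul, norm_pow, norm_neg, norm_one, one_pow, one_mul]
    calc _ ≤ Real.exp (-(b / 3)) ^ k * 1 :=
          mul_le_mul (norm_exp_theta_le hb k) (norm_signModThree_le k) (norm_nonneg _) (by positivity)
      _ = _ := mul_one _
  have hsub (j : ℕ) : Summable fun m => f (j + 3 * m) :=
    hs.comp_injective fun m n h => by simpa using h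
  have h0 := hsub 0
  have h2 := hsub 2
  refine hs.hasSum_iff.2 ?_
  rw [Nat.sumByResidueClasses hs 3]
  change ∑ j : Fin 3, ∑' m, f (j.val + 3 * m) = _
  rw [Fin.sum_univ_three]
  simp only [Fin.val_zero, Fin.val_one, Fin.val_two]
  -- The residue classes 0 and 2 modulo 3 carry the two kinds of pentagonal numbers; class 1 drops
  -- out.
  have h1 : ∀ m, f (1 + 3 * m) = 0 := fun m => by
    have : (1 + 3 * m) % 3 = 1 := by omega
    simp [hf, signModThree, this]
  simp_rw [h1]
  rw [tsum_zero, add_zero, ← h0.tsum_add h2, etaExp, euler_eq_tsum (norm_exp_neg_lt_one hb),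
    ← tsum_mul_left]
  refine tsum_congr fun m => ?_
  rw [mul_left_comm, mul_sub, exp_mul_pow_pentagonal_neg, exp_mul_pow_pentagonal_succ]
  have e2 : (2 + 3 * m) % 3 = 2 := by omega
  simp only [hf, signModThree, e2, pow_add, pow_mul, zero_add]
  norm_num
  ring

/-! ### The frequency recursion -/

/-- The Gaussian factor completes the square in the multiplier of the contour shift, so that the
recursion becomes additive. -/
lemma mordell_rec {α b : ℝ} (hα : 0 < α) (hb : b = Real.pi ^ 2 / α) (k : ℤ) :
    exp (b / 3 * (k + 1 / 2) ^ 2) * mordell α k =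
      exp (b / 3 * ((k - 3 : ℤ) + 1 / 2) ^ 2) * mordell α (k - 3) +
        2 * Real.pi * I / α * exp (b / 3 * (k - 1) ^ 2) := by
  rw [mordell_eq_mordell_sub_three hα, ← hb, mul_add, ← mul_assoc, ← Complex.exp_add,
    mul_left_comm, ← Complex.exp_add]
  congr 3
  · push_cast; ring
  · ring

/-- The weight one half at the endpoint of the summation range. -/
noncomputable def endWeight (k p : ℕ) : ℂ := if k = 3 * p + 1 then 1 / 2 else 1

/-- The residues picked up in lowering the frequency of the `k`-th integral. -/
noncomputable def residueSum (b : ℝ) (k : ℕ) : ℂ :=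
  ∑ p ∈ Finset.range ((k + 2) / 3), endWeight k p * exp (b / 3 * ((k : ℂ) - 1 - 3 * p) ^ 2)

lemma residueSum_add_three (b : ℝ) (k : ℕ) : residueSum b (k + 3) =
    residueSum b k + exp (b / 3 * ((k : ℂ) + 2) ^ 2) := by
  rw [residueSum, residueSum, show (k + 3 + 2) / 3 = (k + 2) / 3 + 1 by omega,
    Finset.sum_range_succ']
  congr 1
  · refine Finset.sum_congr rfl fun p _ => ?_
    have : endWeight (k + 3) (p + 1) = endWeight k p := by
      unfold endWeight
      congr 1
      simp only [eq_iff_iff]; omega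
    rw [this]; congr 2; push_cast; ring
  · have : endWeight (k + 3) 0 = 1 := by simp [endWeight]
    rw [this, one_mul]; congr 1; push_cast; ring

lemma exp_mul_mordell {α b : ℝ} (hα : 0 < α) (hb : b = Real.pi ^ 2 / α) (k : ℕ) :
    exp (b / 3 * ((k : ℂ) + 1 / 2) ^ 2) * mordell α k =
      2 * (Real.sqrt 3 : ℂ) * I * W₃ α * signModThree k +
        2 * Real.pi * I / α * residueSum b k := by
  have hJ0 : exp (b / 3 * ((0 : ℂ) + 1 / 2) ^ 2) * mordell α 0 =
      2 * (Real.sqrt 3 : ℂ) * I * W₃ α := by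
    rw [mordell_zero hα, ← hb, ← mul_assoc, ← Complex.exp_add,
      show (b / 3 * (0 + 1 / 2) ^ 2 + -((b : ℂ) / 12)) = 0 by ring, Complex.exp_zero, one_mul]
  induction k using Nat.strongRec with
  | _ k ih =>
    match k, ih with
    | 0, _ => simpa [signModThree, residueSum] using hJ0
    -- The shift leads from 1 to -2, which reflection sends back to 1 with a minus sign. Solving for
    -- the integral halves the residue, whence `endWeight`, and leaves no `W₃`.
    | 1, _ =>
      have h := mordell_rec hα hb 1
      have hn := mordell_neg α 1
      norm_num at h hn
      rw [hn] at h
      simp only [signModThree, residueSum, endWeight]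
      norm_num
      linear_combination h / 2
    -- The shift leads to -1, and reflection turns that integral into minus the one of frequency 0.
    | 2, _ =>
      have h := mordell_rec hα hb 2
      have hn := mordell_neg α 0
      norm_num at h hn hJ0
      rw [hn] at h
      simp only [signModThree, residueSum, endWeight]
      norm_num
      linear_combination h - hJ0
    | k + 3, ih =>
      have h := mordell_rec hα hb ((k + 3 : ℕ) : ℤ)
      have h' := ih k (by omega)
      rw [show (((k + 3 : ℕ) : ℤ) - 3) = (k : ℤ) by push_cast; ring] at h
      rw [residueSum_add_three, show signModThree (k + 3) = signModThree k by simp [signModThree]]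
      push_cast at h ⊢
      rw [show ((k : ℂ) + 3 - 1) = k + 2 by ring] at h
      linear_combination h + h'

/-- The alternating series `∑ (-1)^n e^(-3a(n+1/2)²) tanh((n+1/2)a)`. -/
noncomputable def tanhSeries (a : ℝ) : ℂ :=
  ∑' n : ℕ, (-1) ^ n * (exp (-(3 * a) * ((n : ℂ) + 1 / 2) ^ 2) * tanh (a * ((n : ℂ) + 1 / 2)))

/-- Weight of the geometric series that sums to `tanh / 2`. -/
noncomputable def halfWeight (l : ℕ) : ℂ := if l = 0 then 1 / 2 else 1

/-- The double series behind the dual term of the transformation law. -/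
noncomputable def doubleTerm (b : ℝ) (x : ℕ × ℕ) : ℂ :=
  -((-1) ^ x.1 * exp (-(3 * b) * ((x.1 : ℂ) + 1 / 2) ^ 2)) *
    (halfWeight x.2 * (-exp (-(2 * b) * ((x.1 : ℂ) + 1 / 2))) ^ x.2)

/-- tanh(u)/2 = 1/(1 + e^(-2u)) - 1/2, and the subtracted half falls on the constant term. -/
lemma hasSum_halfWeight {u : ℝ} (hu : 0 < u) :
    HasSum (fun l => halfWeight l * (-exp (-(2 * u))) ^ l) (tanh u / 2) := by
  have hn : ‖-exp (-(2 * (u : ℂ)))‖ < 1 := by rw [norm_neg]; exact norm_exp_neg_lt_one hu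
  have h1 := (hasSum_geometric_of_norm_lt_one hn).sub (hasSum_ite_eq 0 (1 / 2 : ℂ))
  have hne : 1 + exp (-(2 * (u : ℂ))) ≠ 0 := by
    have : (1 + exp (-(2 * (u : ℂ)))) = ((1 + Real.exp (-(2 * u)) : ℝ) : ℂ) := by push_cast; rfl
    rw [this]; exact ofReal_ne_zero.2 (by positivity)
  have hval : tanh (u : ℂ) / 2 = (1 - -exp (-(2 * (u : ℂ))))⁻¹ - 1 / 2 := by
    have e1 : exp (u : ℂ) ≠ 0 := Complex.exp_ne_zero _
    have e2 : exp (-(2 * (u : ℂ))) = exp (-(u : ℂ)) * exp (-(u : ℂ)) := by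
      rw [← Complex.exp_add]; congr 1; ring
    rw [e2, Complex.exp_neg] at hne
    have hc : 1 + exp (u : ℂ) ^ 2 ≠ 0 := by
      intro h; apply hne; field_simp; linear_combination h
    have hc' : exp (u : ℂ) ^ 2 + 1 ≠ 0 := by rwa [add_comm]
    rw [Complex.tanh_eq_sinh_div_cosh, Complex.sinh, Complex.cosh, e2, Complex.exp_neg, sub_neg_eq_add]
    field_simp
    ring
  rw [hval]
  refine h1.congr_fun fun l => ?_
  by_cases hl : l = 0 <;> simp [halfWeight, hl]
  norm_num

lemma norm_doubleTerm_le {b : ℝ} (hb : 0 < b) (x : ℕ × ℕ) :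
    ‖doubleTerm b x‖ ≤ Real.exp (-b) ^ x.1 * Real.exp (-b) ^ x.2 := by
  obtain ⟨p, l⟩ := x
  have hp : (0 : ℝ) ≤ p := p.cast_nonneg
  have hl : (0 : ℝ) ≤ l := l.cast_nonneg
  have h1 : ‖exp (-(3 * b) * ((p : ℂ) + 1 / 2) ^ 2)‖ ≤ Real.exp (-b) ^ p := by
    rw [show (-(3 * b) * ((p : ℂ) + 1 / 2) ^ 2) = ((-(3 * b) * ((p : ℝ) + 1 / 2) ^ 2 : ℝ) : ℂ) by
      push_cast; ring, ← ofReal_exp, norm_real, Real.norm_of_nonneg (Real.exp_nonneg _),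
      ← Real.exp_nat_mul, Real.exp_le_exp]
    have : (p : ℝ) ≤ 3 * ((p : ℝ) + 1 / 2) ^ 2 := by nlinarith
    nlinarith
  have h2 : ‖(-exp (-(2 * b) * ((p : ℂ) + 1 / 2)))‖ ≤ Real.exp (-b) := by
    rw [norm_neg, show (-(2 * b) * ((p : ℂ) + 1 / 2)) = ((-(2 * b) * ((p : ℝ) + 1 / 2) : ℝ) : ℂ) by
      push_cast; ring, ← ofReal_exp, norm_real, Real.norm_of_nonneg (Real.exp_nonneg _),
      Real.exp_le_exp]
    nlinarith
  have h3 : ‖halfWeight l‖ ≤ 1 := by unfold halfWeight; split_ifs <;> norm_num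
  simp only [doubleTerm]
  rw [norm_mul, norm_neg, norm_mul, norm_mul, norm_pow, norm_neg, norm_one, one_pow, one_mul,
    norm_pow]
  calc _ ≤ Real.exp (-b) ^ p * (1 * Real.exp (-b) ^ l) := by gcongr
    _ = _ := by rw [one_mul]

lemma summable_doubleTerm {b : ℝ} (hb : 0 < b) : Summable (doubleTerm b) := by
  have hg := summable_geometric_of_lt_one (Real.exp_nonneg (-b))
    (by rw [Real.exp_lt_one_iff]; linarith)
  exact (hg.mul_of_nonneg hg (fun n => by positivity) fun n => by positivity).of_norm_bounded
    (norm_doubleTerm_le hb)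

lemma hasSum_doubleTerm {b : ℝ} (hb : 0 < b) :
    HasSum (doubleTerm b) (-(1 / 2) * tanhSeries b) := by
  have hs := (summable_doubleTerm hb).hasSum
  have h1 : ∀ p : ℕ, HasSum (fun l => doubleTerm b (p, l))
      (-(1 / 2) * ((-1) ^ p *
        (exp (-(3 * b) * ((p : ℂ) + 1 / 2) ^ 2) * tanh (b * ((p : ℂ) + 1 / 2))))) := by
    intro p
    have h := (hasSum_halfWeight (u := b * (p + 1 / 2)) (by positivity)).mul_left
      (-((-1) ^ p * exp (-(3 * b) * ((p : ℂ) + 1 / 2) ^ 2)))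
    have hu : ((b * (p + 1 / 2) : ℝ) : ℂ) = b * ((p : ℂ) + 1 / 2) := by push_cast; rfl
    rw [hu] at h
    have hv : -(1 / 2) * ((-1) ^ p *
        (exp (-(3 * b) * ((p : ℂ) + 1 / 2) ^ 2) * tanh (b * ((p : ℂ) + 1 / 2)))) =
        -((-1) ^ p * exp (-(3 * b) * ((p : ℂ) + 1 / 2) ^ 2)) *
          (tanh (b * ((p : ℂ) + 1 / 2)) / 2) := by ring
    rw [hv]
    refine h.congr_fun fun l => ?_
    rw [doubleTerm, show -(2 * (b : ℂ)) * ((p : ℂ) + 1 / 2) = -(2 * (b * ((p : ℂ) + 1 / 2))) by ring]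
  have h2 := hs.prod_fiberwise h1
  rw [tanhSeries, ← tsum_mul_left, h2.tsum_eq]
  exact hs

/-- The double series arranged by frequency. -/
lemma hasSum_residueSum {b : ℝ} (hb : 0 < b) :
    HasSum (fun k : ℕ => (-1) ^ k * exp (-((b : ℂ) / 3) * ((k : ℂ) + 1 / 2) ^ 2) * residueSum b k)
      (-(1 / 2) * tanhSeries b) := by
  set H : ℕ × ℕ → ℂ := fun x => if 3 * x.2 + 1 ≤ x.1 then
    (-1) ^ x.1 * exp (-((b : ℂ) / 3) * ((x.1 : ℂ) + 1 / 2) ^ 2) *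
      (endWeight x.1 x.2 * exp (b / 3 * ((x.1 : ℂ) - 1 - 3 * x.2) ^ 2)) else 0 with hH
  -- With l = k - 1 - 3p the difference of squares (k + 1/2)² - l² equals 9(p + 1/2)² + 6l(p + 1/2),
  -- so a Gaussian in p times a geometric series in l appears. The end weight 1/2 sits at l = 0.
  set e : ℕ × ℕ → ℕ × ℕ := fun x => (3 * x.1 + 1 + x.2, x.1) with he
  have hinj : Function.Injective e := by
    rintro ⟨p, l⟩ ⟨p', l'⟩ h
    simp only [he, Prod.mk.injEq] at h ⊢
    omega
  have hcomp : H ∘ e = doubleTerm b := by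
    ext ⟨p, l⟩
    have hle : 3 * p + 1 ≤ 3 * p + 1 + l := by omega
    have hw : endWeight (3 * p + 1 + l) p = halfWeight l := by
      simp [endWeight, halfWeight]
    have hsign : (-1 : ℂ) ^ (3 * p + 1 + l) = -((-1) ^ p * (-1) ^ l) := by
      rw [pow_add, pow_add, pow_mul]; norm_num
    simp only [hH, he, Function.comp_apply, hle, if_true, hw, hsign, doubleTerm]
    rw [neg_pow (exp _), ← Complex.exp_nat_mul]
    have : exp (-((b : ℂ) / 3) * (((3 * p + 1 + l : ℕ) : ℂ) + 1 / 2) ^ 2) *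
        exp (b / 3 * (((3 * p + 1 + l : ℕ) : ℂ) - 1 - 3 * p) ^ 2) =
        exp (-(3 * b) * ((p : ℂ) + 1 / 2) ^ 2) *
          exp (l * (-(2 * b) * ((p : ℂ) + 1 / 2))) := by
      rw [← Complex.exp_add, ← Complex.exp_add]; congr 1; push_cast; ring
    linear_combination (-((-1) ^ p * (-1) ^ l) * halfWeight l : ℂ) * this
  have hsum : HasSum H (-(1 / 2) * tanhSeries b) := by
    rw [← hinj.hasSum_iff, hcomp]
    · exact hasSum_doubleTerm hb
    · rintro ⟨k, p⟩ hx
      simp only [hH]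
      rw [if_neg]
      intro hle
      replace hle : 3 * p + 1 ≤ k := hle
      obtain ⟨l, rfl⟩ := Nat.exists_eq_add_of_le hle
      exact hx ⟨(p, l), rfl⟩
  refine hsum.prod_fiberwise fun k => ?_
  have hfin : HasSum (fun p => H (k, p)) (∑ p ∈ Finset.range ((k + 2) / 3), H (k, p)) := by
    refine hasSum_sum_of_ne_finset_zero fun p hp => ?_
    simp only [Finset.mem_range, not_lt] at hp
    simp only [hH]
    rw [if_neg]; omega
  convert hfin using 1
  rw [residueSum, Finset.mul_sum]
  refine Finset.sum_congr rfl fun p hp => ?_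
  simp only [Finset.mem_range] at hp
  simp only [hH]
  rw [if_pos (by omega)]

lemma hasSum_mordell {α b : ℝ} (hα : 0 < α) (hb : b = Real.pi ^ 2 / α) :
    HasSum (fun k : ℕ => (-1) ^ k * mordell α k)
      (2 * (Real.sqrt 3 : ℂ) * I * W₃ α * etaExp b +
        2 * Real.pi * I / α * (-(1 / 2) * tanhSeries b)) := by
  have hb0 : 0 < b := by rw [hb]; have := Real.pi_pos; positivity
  refine (((hasSum_etaExp hb0).mul_left (2 * (Real.sqrt 3 : ℂ) * I * W₃ α)).add
    ((hasSum_residueSum hb0).mul_left (2 * Real.pi * I / α))).congr_fun fun k => ?_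
  have h := exp_mul_mordell hα hb k
  have he : exp (-((b : ℂ) / 3) * ((k : ℂ) + 1 / 2) ^ 2) *
      exp (b / 3 * ((k : ℂ) + 1 / 2) ^ 2) = 1 := by
    rw [← Complex.exp_add, neg_mul, neg_add_cancel, Complex.exp_zero]
  linear_combination ((-1) ^ k * exp (-((b : ℂ) / 3) * ((k : ℂ) + 1 / 2) ^ 2)) * h -
    ((-1) ^ k * mordell α k) * he

/-! ### Poisson summation -/

lemma tsum_int_eq_two_mul {g : ℤ → ℂ} (hg : ∀ n : ℕ, g (-((n : ℤ) + 1)) = g n)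
    (hs : Summable fun n : ℕ => g n) : ∑' n : ℤ, g n = 2 * ∑' n : ℕ, g n := by
  rw [tsum_of_nat_of_neg_add_one hs (hs.congr fun n => (hg n).symm), two_mul]
  congr 1
  exact tsum_congr hg

lemma fourier_gaussWave_tanh (α : ℝ) (n : ℤ) :
    FourierTransform.fourier (fun x : ℝ => gaussWave α 0 x * tanh (α * x)) (n : ℝ) =
      mordell α (-n) := by
  rw [Real.fourier_real_eq_integral_exp_smul, mordell]
  congr 1
  ext x
  rw [smul_eq_mul, ← mul_assoc]
  congr 1
  simp only [gaussWave]
  rw [← Complex.exp_add]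
  congr 1
  push_cast
  ring

lemma gaussWave_half_add (α : ℝ) (n : ℤ) : gaussWave α 0 ((1 / 2 : ℝ) + n : ℝ) =
    I * ((-1) ^ n * exp (-(3 * α) * ((n : ℂ) + 1 / 2) ^ 2)) := by
  have h1 : I * (-1 : ℂ) ^ n = exp (Real.pi / 2 * I) * exp (n * (Real.pi * I)) := by
    rw [Complex.exp_int_mul, exp_pi_mul_I, exp_pi_div_two_mul_I]
  rw [← mul_assoc, h1, ← Complex.exp_add, ← Complex.exp_add, gaussWave]
  congr 1
  push_cast
  ring

lemma isBigO_gaussWave_tanh {α : ℝ} (hα : 0 < α) :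
    (fun x : ℝ => gaussWave α 0 x * tanh (α * x)) =O[cocompact ℝ] fun x : ℝ => |x| ^ (-2 : ℝ) := by
  have h := cexp_neg_quadratic_isLittleO_abs_rpow_cocompact (a := -(3 * α)) (by simpa using hα)
    (Real.pi * I) (-2)
  refine IsBigO.trans (IsBigO.of_bound 2 (Eventually.of_forall fun x => ?_)) h.isBigO
  have ht := norm_tanh_le_two_of_cos (x := α * x) (y := 0) (by norm_num)
  rw [norm_mul, mul_comm]
  have e : gaussWave α 0 x = exp (-(3 * α) * x ^ 2 + Real.pi * I * x) := by
    simp [gaussWave]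
  rw [e]
  gcongr
  simpa using ht

/-- Poisson summation at the shift 1/2, where e^(πix) takes the values i(-1)^n. Both bilateral sums
are symmetric under n ↦ -1 - n, so each is twice its half. Summability on the Fourier side is
supplied by the explicit evaluation in `hasSum_mordell`. -/
lemma tanhSeries_eq_tsum_mordell {α : ℝ} (hα : 0 < α)
    (hs : Summable fun k : ℕ => (-1) ^ k * mordell α k) :
    I * tanhSeries α = ∑' k : ℕ, (-1) ^ k * mordell α k := by
  have hcont : Continuous fun x : ℝ => gaussWave α 0 x * tanh (α * x) := by
    have := continuous_tanh_add (α := α) (y := 0) (by simp)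
    simp only [ofReal_zero, zero_mul, add_zero] at this
    exact ((differentiable_gaussWave α 0).continuous.comp continuous_ofReal).mul this
  have hnat : Summable fun k : ℕ => mordell α k := by
    refine (hs.norm.congr fun k => ?_).of_norm
    simp
  have hint : Summable fun n : ℤ => mordell α (-n) := by
    have : Summable fun n : ℤ => mordell α n := by
      refine Summable.of_nat_of_neg_add_one hnat (hnat.neg.congr fun k => ?_)
      rw [← mordell_neg]; congr 1; ring
    exact (Equiv.neg ℤ).summable_iff.2 this
  have key := Real.tsum_eq_tsum_fourier_of_rpow_decay_of_summable hcont one_lt_two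
    (isBigO_gaussWave_tanh hα) (by simpa only [fourier_gaussWave_tanh] using hint) (1 / 2)
  simp only [fourier_gaussWave_tanh] at key
  have hsign (n : ℤ) : (-1 : ℂ) ^ (-(n + 1)) = -(-1) ^ n := by
    rw [zpow_neg, zpow_add₀ (by norm_num), zpow_one, mul_neg_one, inv_neg, ← inv_zpow,
      inv_neg, inv_one]
  have hl : ∑' n : ℤ, gaussWave α 0 ((1 / 2 : ℝ) + n : ℝ) * tanh (α * ((1 / 2 : ℝ) + n : ℝ)) =
      2 * (I * tanhSeries α) := by
    rw [tsum_int_eq_two_mul, tanhSeries, ← tsum_mul_left (a := I)]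
    · congr 1
      refine tsum_congr fun n => ?_
      rw [gaussWave_half_add]
      push_cast
      rw [zpow_natCast, add_comm (1 / 2 : ℂ)]; ring
    · intro n
      rw [gaussWave_half_add, gaussWave_half_add, hsign,
        show (α : ℂ) * ((1 / 2 : ℝ) + (-((n : ℤ) + 1) : ℤ) : ℝ) =
          -(α * ((1 / 2 : ℝ) + (n : ℤ) : ℝ)) by push_cast; ring, Complex.tanh_neg]
      push_cast
      rw [show (-((n : ℂ) + 1) + 1 / 2) = -((n : ℂ) + 1 / 2) by ring, neg_sq]
      ring
    · have hlt : Real.exp (-α) < 1 := by rw [Real.exp_lt_one_iff]; linarith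
      refine ((summable_geometric_of_lt_one (Real.exp_nonneg _) hlt).mul_right 2).of_norm_bounded
        fun n => ?_
      have ht := norm_tanh_le_two_of_cos (x := α * (1 / 2 + n)) (y := 0) (by norm_num)
      rw [norm_mul]
      gcongr
      · rw [gaussWave_half_add, norm_mul, norm_I, one_mul, norm_mul, norm_zpow, norm_neg, norm_one,
          one_zpow, one_mul]
        push_cast
        rw [show (-(3 * α) * ((n : ℂ) + 1 / 2) ^ 2) =
          ((-(3 * α) * ((n : ℝ) + 1 / 2) ^ 2 : ℝ) : ℂ) by push_cast; ring, ← ofReal_exp,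
          norm_real, Real.norm_of_nonneg (Real.exp_nonneg _), ← Real.exp_nat_mul, Real.exp_le_exp]
        have hn : (0 : ℝ) ≤ n := n.cast_nonneg
        have : (n : ℝ) ≤ 3 * ((n : ℝ) + 1 / 2) ^ 2 := by nlinarith
        nlinarith
      · push_cast at ht ⊢
        simpa using ht
  have hr : ∑' n : ℤ, mordell α (-n) * fourier n ((1 / 2 : ℝ) : UnitAddCircle) =
      2 * ∑' k : ℕ, (-1) ^ k * mordell α k := by
    have hf (n : ℤ) : (fourier n ((1 / 2 : ℝ) : UnitAddCircle) : ℂ) = (-1) ^ (-n) := by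
      rw [fourier_coe_apply, zpow_neg, ← inv_zpow, inv_neg, inv_one, ← exp_pi_mul_I,
        ← Complex.exp_int_mul]
      congr 1
      push_cast
      ring
    simp_rw [hf]
    have hneg := (Equiv.neg ℤ).tsum_eq (fun n => mordell α n * (-1 : ℂ) ^ n)
    simp only [Equiv.neg_apply] at hneg
    rw [hneg, tsum_int_eq_two_mul]
    · congr 1
      refine tsum_congr fun n => ?_
      rw [zpow_natCast, mul_comm]
    · intro n
      rw [hsign, show (-((n : ℤ) + 1)) = -1 - (n : ℤ) by ring, mordell_neg]
      ring
    · refine hs.congr fun k => ?_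
      rw [zpow_natCast, mul_comm]
  have h2 : (2 : ℂ) ≠ 0 := two_ne_zero
  refine mul_left_cancel₀ h2 ?_
  rw [← hl, ← hr]
  exact key

/-- The transformation law of the `tanh` series. -/
lemma tanhSeries_eq {α b : ℝ} (hα : 0 < α) (hb : b = Real.pi ^ 2 / α) : tanhSeries α =
    -(Real.pi / α) * tanhSeries b + 2 * (Real.sqrt 3 : ℂ) * etaExp b * W₃ α := by
  have h := hasSum_mordell hα hb
  have h1 := tanhSeries_eq_tsum_mordell hα h.summable
  rw [h.tsum_eq] at h1
  refine mul_left_cancel₀ I_ne_zero ?_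
  rw [h1]; ring

/-! ### The transformation law and the conclusion -/

/-- The mock theta function at `-q` as a quotient of the `tanh` series by `η`. -/
lemma qPow_mul_omega {α : ℝ} (hα : 0 < α) :
    qPow (2 / 3) α * omega (-q α) = tanhSeries α / etaExp α := by
  have hE : euler (exp (-(2 * (α : ℂ)))) ≠ 0 := euler_ne_zero (norm_exp_neg_lt_one hα)
  have hq2 : (-q α) ^ 2 = exp (-(2 * (α : ℂ))) := by
    rw [neg_sq, q, ← Complex.exp_nat_mul]; congr 1; push_cast; ring
  rw [omega, hq2, etaExp, mul_div_assoc', div_eq_div_iff hE (mul_ne_zero (Complex.exp_ne_zero _) hE)]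
  have hn : exp (-α / 12) * qPow (2 / 3) α * numer (-q α) = tanhSeries α := by
    rw [numer, tanhSeries, ← tsum_mul_left]
    refine tsum_congr fun n => ?_
    have hodd : (-q α) ^ (2 * n + 1) = -exp (-(2 * (α * ((n : ℂ) + 1 / 2)))) := by
      rw [Odd.neg_pow ⟨n, rfl⟩, q, ← Complex.exp_nat_mul]
      congr 2; push_cast; ring
    have heven : (-q α) ^ (3 * n * (n + 1)) = exp (-(3 * n * (n + 1) * α : ℂ)) := by
      have : Even (3 * n * (n + 1)) := by
        rw [mul_assoc]; exact (Nat.even_mul_succ_self n).mul_left 3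
      rw [this.neg_pow, q, ← Complex.exp_nat_mul]
      congr 1; push_cast; ring
    -- The exponent 2/3 of the law and the 1/12 of η add up to 3/4, which completes 3n(n + 1) to 3(n
    -- + 1/2)².
    have hexp : exp (-α / 12) * qPow (2 / 3) α * exp (-(3 * n * (n + 1) * α : ℂ)) =
        exp (-(3 * α) * ((n : ℂ) + 1 / 2) ^ 2) := by
      rw [qPow, ← Complex.exp_add, ← Complex.exp_add]
      congr 1; push_cast; ring
    have htanh : (1 + -exp (-(2 * (α * ((n : ℂ) + 1 / 2))))) /
        (1 - -exp (-(2 * (α * ((n : ℂ) + 1 / 2))))) = tanh (α * ((n : ℂ) + 1 / 2)) := by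
      generalize hu : (α * ((n : ℂ) + 1 / 2)) = u
      have e1 : exp u ≠ 0 := Complex.exp_ne_zero _
      have e2 : exp (-(2 * u)) = exp (-u) * exp (-u) := by
        rw [← Complex.exp_add]; congr 1; ring
      rw [Complex.tanh_eq_sinh_div_cosh, Complex.sinh, Complex.cosh, e2, div_div_div_cancel_right₀
        two_ne_zero, ← mul_div_mul_left _ _ e1]
      have e3 : exp u * exp (-u) = 1 := by rw [← Complex.exp_add, add_neg_cancel, Complex.exp_zero]
      congr 1
      · linear_combination (-exp (-u)) * e3
      · linear_combination (exp (-u)) * e3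
    rw [hodd, heven, htanh, ← hexp]
    ring
  rw [← hn]
  ring

/-- Dividing `tanhSeries_eq` by η(α) and inserting η(b) = √(α/π) η(α), where b = π²/α, turns π/α
into √(π/α) and 2√3 into √(12α/π). -/
lemma transformationLaw_omega : TransformationLaw omega := by
  intro α hα
  have hπ := Real.pi_pos
  set b : ℝ := Real.pi ^ 2 / α with hb
  have hb0 : 0 < b := by positivity
  have hbc : ((b : ℝ) : ℂ) = (Real.pi : ℂ) ^ 2 / α := by rw [hb]; push_cast; rfl
  have hq1 : q₁Pow (2 / 3) α * omega (-q₁ α) = tanhSeries b / etaExp b := by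
    rw [← qPow_mul_omega hb0, q₁Pow, q₁, qPow, q, hbc]
  have heta := etaExp_pi_sq_div_ofReal hα
  rw [← hb] at heta
  have hne (a : ℝ) (ha : 0 < a) : etaExp a ≠ 0 :=
    mul_ne_zero (Complex.exp_ne_zero _) (euler_ne_zero (norm_exp_neg_lt_one ha))
  have h1 := hne α hα
  have hαπ : 0 < α / Real.pi := by positivity
  have hs : (Real.sqrt (α / Real.pi) : ℂ) ≠ 0 :=
    ofReal_ne_zero.2 (Real.sqrt_pos.2 hαπ).ne'
  have hs2 : (Real.sqrt (α / Real.pi) : ℂ) ^ 2 = α / Real.pi := by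
    rw [← ofReal_pow, Real.sq_sqrt hαπ.le]; push_cast; rfl
  have hinv : (Real.sqrt (Real.pi / α) : ℂ) = (Real.sqrt (α / Real.pi) : ℂ)⁻¹ := by
    rw [← ofReal_inv, ← Real.sqrt_inv, inv_div]
  have h12 : (Real.sqrt (12 * α / Real.pi) : ℂ) =
      2 * (Real.sqrt 3 : ℂ) * (Real.sqrt (α / Real.pi) : ℂ) := by
    rw [show 12 * α / Real.pi = 2 ^ 2 * 3 * (α / Real.pi) by ring,
      Real.sqrt_mul (by norm_num), Real.sqrt_mul (by norm_num), Real.sqrt_sq (by norm_num)]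
    push_cast; rfl
  have hr : (Real.pi : ℂ) / α = ((Real.sqrt (α / Real.pi) : ℂ) ^ 2)⁻¹ := by rw [hs2, inv_div]
  rw [mul_assoc, hq1, qPow_mul_omega hα, tanhSeries_eq hα hb, heta, hinv, h12, hr]
  generalize (Real.sqrt (α / Real.pi) : ℂ) = s at hs
  field_simp

end MockThree

/-- For each opening `0 < θ₀ < π/2` there is one and only one function on the open unit disk that
is holomorphic and satisfies the transformation law and the growth bound. -/
theorem lemma4p3 (θ₀ : ℝ) (hθ₀ : 0 < θ₀) (hθ₀' : θ₀ < Real.pi / 2) :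
    ∃ ω : ℂ → ℂ, MockThree.IsSolution θ₀ ω ∧
      ∀ ω' : ℂ → ℂ, MockThree.IsSolution θ₀ ω' →
        Set.EqOn ω' ω (Metric.ball (0 : ℂ) 1) := by
  have h : MockThree.IsSolution θ₀ MockThree.omega :=
    ⟨MockThree.differentiableOn_omega, MockThree.transformationLaw_omega,
      MockThree.growthBound_omega hθ₀ hθ₀'⟩
  exact ⟨MockThree.omega, h, fun ω' h' => h.eqOn hθ₀ h'⟩
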